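/- Let $d\in\mathbb N$ and $\mathbb R^d_+=(0,\infty)^d$; functions and sequences take values in $\mathbb K$, where $\mathbb K=\mathbb R$ or $\mathbb K=\mathbb C$. Let $\mathcal S(\mathbb R^d_+)$ be the space of all $f\in C^\infty(\mathbb R^d_+)$ such that every partial derivative $D^pf$, $p\in\mathbb N_0^d$, extends to a continuous function on $[0,\infty)^d$ and $$\sup_{x\in\mathbb R^d_+}x^k|D^pf(x)|<\infty\qquad\text{for all }k,p\in\mathbb N_0^d,$$ with the locally convex topology defined by these seminorms. Let $s$ be the space of all families $\{a_n\}_{n\in\mathbb N_0^d}$ with $$\sum_{n\in\mathbb N_0^d}|a_n|^2(1+|n|)^{2k}<\infty\qquad\text{for all }k\in\mathbb N_0,\qquad |n|=n_1+\dots+n_d,$$ with the locally convex topology defined by the square roots of these sums. For $m\in\mathbb N_0$ and $t>0$ let $$L_m(t)=\frac{e^t}{m!}\Big(\frac{d}{dt}\Big)^m(e^{-t}t^m),\qquad \mathcal L_m(t)=L_m(t)e^{-t/2},$$ and for $n\in\mathbb N_0^d$, $x\in\mathbb R^d_+$ let $\mathcal L_n(x)=\prod_{i=1}^d\mathcal L_{n_i}(x_i)$;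 these functions belong to $\mathcal S(\mathbb R^d_+)$. For $f\in\mathcal S(\mathbb R^d_+)$ and $n\in\mathbb N_0^d$ let $a_n(f)=\int_{\mathbb R^d_+}f(x)\mathcal L_n(x)\,dx$ (the integrand is integrable). Then the series $\sum_{n\in\mathbb N_0^d}a_n(f)\mathcal L_n$ converges absolutely in $\mathcal S(\mathbb R^d_+)$, i.e. $\sum_{n}q(a_n(f)\mathcal L_n)<\infty$ for every continuous seminorm $q$ on $\mathcal S(\mathbb R^d_+)$, and its sum in $\mathcal S(\mathbb R^d_+)$ is $f$. Moreover, $\iota(f)=\{a_n(f)\}_{n\in\mathbb N_0^d}$ defines a topological isomorphism (a linear bijection, continuous in both directions) $\iota:\mathcal S(\mathbb R^d_+)\to s$. -/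

import Mathlib

open scoped ContDiff

noncomputable section

namespace LaguerreOrthant

/-- The open orthant `(0, ∞)^d`. -/
def orthant (d : ℕ) : Set (Fin d → ℝ) := {x | ∀ i, 0 < x i}

/-- The closed orthant `[0, ∞)^d`. -/
def closedOrthant (d : ℕ) : Set (Fin d → ℝ) := {x | ∀ i, 0 ≤ x i}

section Derivatives

variable {𝕜 : Type*} [RCLike 𝕜] {d : ℕ}

/-- The partial derivative `∂f/∂x_i`. -/
def pderiv (i : Fin d) (f : (Fin d → ℝ) → 𝕜) : (Fin d → ℝ) → 𝕜 :=
  fun x => fderiv ℝ f x (Pi.single i 1)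

/-- The iterated partial derivative `D^p = ∂_1^{p_1} ⋯ ∂_d^{p_d}`. -/
def multiDeriv (p : Fin d → ℕ) (f : (Fin d → ℝ) → 𝕜) : (Fin d → ℝ) → 𝕜 :=
  (List.finRange d).foldr (fun i g => (pderiv i)^[p i] g) f

theorem isOpen_orthant (d : ℕ) : IsOpen (orthant d) := by
  have : orthant d = ⋂ i, {x : Fin d → ℝ | 0 < x i} := by
    ext x; simp [orthant]
  rw [this]
  exact isOpen_iInter_of_finite fun i => isOpen_lt continuous_const (continuous_apply i)

instance : Nonempty (orthant d) := ⟨⟨fun _ => 1, fun _ => one_pos⟩⟩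

theorem multiDeriv_induct
    {P : ((Fin d → ℝ) → 𝕜) → ((Fin d → ℝ) → 𝕜) → ((Fin d → ℝ) → 𝕜) → Prop}
    (hP : ∀ i f g h, P f g h → P (pderiv i f) (pderiv i g) (pderiv i h))
    (p : Fin d → ℕ) {f g h : (Fin d → ℝ) → 𝕜} (h0 : P f g h) :
    P (multiDeriv p f) (multiDeriv p g) (multiDeriv p h) := by
  unfold multiDeriv
  induction List.finRange d with
  | nil => exact h0
  | cons i l ih =>
    simp only [List.foldr_cons]
    generalize p i = m
    induction m with
    | zero => exact ih
    | succ m ihm =>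
      simp only [Function.iterate_succ_apply']
      exact hP i _ _ _ ihm

theorem contDiffOn_pderiv (i : Fin d) {f : (Fin d → ℝ) → 𝕜}
    (hf : ContDiffOn ℝ ∞ f (orthant d)) : ContDiffOn ℝ ∞ (pderiv i f) (orthant d) :=
  (hf.fderiv_of_isOpen (isOpen_orthant d) (by simp)).clm_apply contDiffOn_const

theorem pderiv_congr (i : Fin d) {f g : (Fin d → ℝ) → 𝕜}
    (h : Set.EqOn f g (orthant d)) : Set.EqOn (pderiv i f) (pderiv i g) (orthant d) := by
  intro x hx
  have : f =ᶠ[nhds x] g := h.eventuallyEq_of_mem ((isOpen_orthant d).mem_nhds hx)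
  simp only [pderiv, this.fderiv_eq]

theorem differentiableAt_of_contDiffOn {f : (Fin d → ℝ) → 𝕜}
    (hf : ContDiffOn ℝ ∞ f (orthant d)) {x : Fin d → ℝ} (hx : x ∈ orthant d) :
    DifferentiableAt ℝ f x :=
  (hf.contDiffAt ((isOpen_orthant d).mem_nhds hx)).differentiableAt (by simp)

theorem multiDeriv_add (p : Fin d → ℕ) {f g : (Fin d → ℝ) → 𝕜}
    (hf : ContDiffOn ℝ ∞ f (orthant d)) (hg : ContDiffOn ℝ ∞ g (orthant d)) :
    Set.EqOn (multiDeriv p (f + g)) (multiDeriv p f + multiDeriv p g) (orthant d) := by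
  refine (multiDeriv_induct (P := fun f g h => ContDiffOn ℝ ∞ f (orthant d) ∧
    ContDiffOn ℝ ∞ g (orthant d) ∧ Set.EqOn h (f + g) (orthant d)) ?_ p
    ⟨hf, hg, fun _ _ => rfl⟩).2.2
  rintro i f g h ⟨hf, hg, hh⟩
  refine ⟨contDiffOn_pderiv i hf, contDiffOn_pderiv i hg, fun x hx => ?_⟩
  rw [pderiv_congr i hh hx]
  simp [pderiv, fderiv_add (differentiableAt_of_contDiffOn hf hx)
    (differentiableAt_of_contDiffOn hg hx)]

theorem multiDeriv_smul (p : Fin d → ℕ) (c : 𝕜) {f : (Fin d → ℝ) → 𝕜}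
    (hf : ContDiffOn ℝ ∞ f (orthant d)) :
    Set.EqOn (multiDeriv p (c • f)) (c • multiDeriv p f) (orthant d) := by
  refine (multiDeriv_induct (P := fun f _ h => ContDiffOn ℝ ∞ f (orthant d) ∧
    Set.EqOn h (c • f) (orthant d)) ?_ p (g := f) ⟨hf, fun _ _ => rfl⟩).2
  rintro i f - h ⟨hf, hh⟩
  refine ⟨contDiffOn_pderiv i hf, fun x hx => ?_⟩
  rw [pderiv_congr i hh hx]
  simp [pderiv, fderiv_const_smul (differentiableAt_of_contDiffOn hf hx)]

theorem multiDeriv_zero (p : Fin d → ℕ) :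
    multiDeriv p (0 : (Fin d → ℝ) → 𝕜) = 0 := by
  refine multiDeriv_induct (P := fun f _ _ => f = 0) ?_ p (g := 0) (h := 0) rfl
  rintro i f - - rfl
  funext x
  simp [pderiv]

theorem prod_pow_nonneg (k : Fin d → ℕ) {x : Fin d → ℝ} (hx : x ∈ orthant d) :
    0 ≤ ∏ i, x i ^ k i :=
  Finset.prod_nonneg fun i _ => pow_nonneg (hx i).le _

end Derivatives

section Space

variable (𝕜 : Type*) [RCLike 𝕜] (d : ℕ)

/-- The vector space underlying `𝒮(ℝ^d_+)`. A function on the open orthant is represented by its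
extension by zero to `ℝ^d`; all conditions concern the open orthant only. -/
def schwartzSubmodule : Submodule 𝕜 ((Fin d → ℝ) → 𝕜) where
  carrier := {f |
    (∀ x, x ∉ orthant d → f x = 0) ∧
    ContDiffOn ℝ ∞ f (orthant d) ∧
    (∀ p : Fin d → ℕ, ∃ g : (Fin d → ℝ) → 𝕜,
      ContinuousOn g (closedOrthant d) ∧ Set.EqOn g (multiDeriv p f) (orthant d)) ∧
    ∀ k p : Fin d → ℕ,
      BddAbove (Set.range fun x : orthant d => (∏ i, x.1 i ^ k i) * ‖multiDeriv p f x.1‖)}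
  add_mem' := by
    rintro f g ⟨hf0, hf1, hf2, hf3⟩ ⟨hg0, hg1, hg2, hg3⟩
    refine ⟨fun x hx => by simp [hf0 x hx, hg0 x hx], hf1.add hg1, fun p => ?_, fun k p => ?_⟩
    · obtain ⟨u, hu, hu'⟩ := hf2 p
      obtain ⟨v, hv, hv'⟩ := hg2 p
      refine ⟨u + v, hu.add hv, fun x hx => ?_⟩
      rw [multiDeriv_add p hf1 hg1 hx]
      simp [hu' hx, hv' hx]
    · obtain ⟨A, hA⟩ := hf3 k p
      obtain ⟨B, hB⟩ := hg3 k p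
      refine ⟨A + B, ?_⟩
      rintro _ ⟨x, rfl⟩
      have h1 := hA ⟨x, rfl⟩
      have h2 := hB ⟨x, rfl⟩
      have h3 := prod_pow_nonneg k x.2
      simp only at h1 h2 ⊢
      rw [multiDeriv_add p hf1 hg1 x.2]
      have := mul_le_mul_of_nonneg_left (norm_add_le (multiDeriv p f x.1) (multiDeriv p g x.1)) h3
      simp only [Pi.add_apply]
      linarith
  zero_mem' := by
    refine ⟨fun _ _ => rfl, contDiffOn_const, fun p => ⟨0, continuousOn_const, ?_⟩, fun k p => ?_⟩
    · rw [multiDeriv_zero]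
      exact fun _ _ => rfl
    · refine ⟨0, ?_⟩
      rintro _ ⟨x, rfl⟩
      simp [multiDeriv_zero]
  smul_mem' := by
    rintro c f ⟨hf0, hf1, hf2, hf3⟩
    refine ⟨fun x hx => by simp [hf0 x hx], contDiffOn_const.smul hf1, fun p => ?_, fun k p => ?_⟩
    · obtain ⟨u, hu, hu'⟩ := hf2 p
      refine ⟨c • u, hu.const_smul c, fun x hx => ?_⟩
      rw [multiDeriv_smul p c hf1 hx]
      simp [hu' hx]
    · obtain ⟨A, hA⟩ := hf3 k p
      refine ⟨‖c‖ * A, ?_⟩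
      rintro _ ⟨x, rfl⟩
      have h1 := hA ⟨x, rfl⟩
      simp only at h1 ⊢
      rw [multiDeriv_smul p c hf1 x.2, Pi.smul_apply, norm_smul, mul_left_comm]
      exact mul_le_mul_of_nonneg_left h1 (norm_nonneg c)

/-- The space `𝒮(ℝ^d_+)` (a type synonym, so that it does not carry the topology of pointwise
convergence). -/
def SchwartzOrthant : Type _ := ↥(schwartzSubmodule 𝕜 d)

instance : AddCommGroup (SchwartzOrthant 𝕜 d) :=
  inferInstanceAs (AddCommGroup ↥(schwartzSubmodule 𝕜 d))

instance : Module 𝕜 (SchwartzOrthant 𝕜 d) :=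
  inferInstanceAs (Module 𝕜 ↥(schwartzSubmodule 𝕜 d))

instance : CoeFun (SchwartzOrthant 𝕜 d) (fun _ => (Fin d → ℝ) → 𝕜) := ⟨fun f => f.1⟩

/-- The seminorm `f ↦ sup_{x ∈ ℝ^d_+} x^k |D^p f(x)|`. -/
def schwartzSeminorm (k p : Fin d → ℕ) : Seminorm 𝕜 (SchwartzOrthant 𝕜 d) :=
  Seminorm.of (fun f => ⨆ x : orthant d, (∏ i, x.1 i ^ k i) * ‖multiDeriv p f.1 x.1‖)
    (by
      intro f g
      refine ciSup_le fun x => ?_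
      have h1 := le_ciSup (f.2.2.2.2 k p) x
      have h2 := le_ciSup (g.2.2.2.2 k p) x
      have h3 := prod_pow_nonneg k x.2
      change (∏ i, x.1 i ^ k i) * ‖multiDeriv p (f.1 + g.1) x.1‖ ≤ _
      rw [multiDeriv_add p f.2.2.1 g.2.2.1 x.2]
      have := mul_le_mul_of_nonneg_left
        (norm_add_le (multiDeriv p f.1 x.1) (multiDeriv p g.1 x.1)) h3
      simp only [Pi.add_apply] at *
      linarith)
    (by
      intro c f
      rw [Real.mul_iSup_of_nonneg (norm_nonneg c)]
      refine iSup_congr fun x => ?_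
      change (∏ i, x.1 i ^ k i) * ‖multiDeriv p (c • f.1) x.1‖ = _
      rw [multiDeriv_smul p c f.2.2.1 x.2, Pi.smul_apply, norm_smul, mul_left_comm])

/-- The defining family of seminorms of `𝒮(ℝ^d_+)`, indexed by pairs `(k, p)` of multi-indices. -/
def schwartzSeminormFamily :
    SeminormFamily 𝕜 (SchwartzOrthant 𝕜 d) ((Fin d → ℕ) × (Fin d → ℕ)) :=
  fun kp => schwartzSeminorm 𝕜 d kp.1 kp.2

/-- The locally convex topology of `𝒮(ℝ^d_+)`. -/
instance : TopologicalSpace (SchwartzOrthant 𝕜 d) :=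
  (schwartzSeminormFamily 𝕜 d).moduleFilterBasis.topology'

theorem schwartz_withSeminorms : WithSeminorms (schwartzSeminormFamily 𝕜 d) := ⟨rfl⟩

/-- The terms `|a_n|² (1 + |n|)^{2k}` of the weighted `ℓ²` sums that define `s`; here
`|n| = n_1 + ⋯ + n_d`. -/
def rapidTerm {𝕜 : Type*} [RCLike 𝕜] {d : ℕ} (k : ℕ) (a : (Fin d → ℕ) → 𝕜) (n : Fin d → ℕ) : ℝ :=
  ‖a n‖ ^ 2 * (1 + ((∑ i, n i : ℕ) : ℝ)) ^ (2 * k)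

theorem rapidTerm_eq {𝕜 : Type*} [RCLike 𝕜] {d : ℕ} (k : ℕ) (a : (Fin d → ℕ) → 𝕜)
    (n : Fin d → ℕ) :
    rapidTerm k a n = (‖a n‖ * (1 + ((∑ i, n i : ℕ) : ℝ)) ^ k) ^ (2 : ℝ) := by
  rw [rapidTerm, Real.rpow_two, mul_pow, ← pow_mul, mul_comm k 2]

theorem rapidTerm_nonneg {𝕜 : Type*} [RCLike 𝕜] {d : ℕ} (k : ℕ) (a : (Fin d → ℕ) → 𝕜)
    (n : Fin d → ℕ) : 0 ≤ rapidTerm k a n := by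
  unfold rapidTerm; positivity

theorem rapidTerm_add_le {𝕜 : Type*} [RCLike 𝕜] {d : ℕ} (k : ℕ) (a b : (Fin d → ℕ) → 𝕜)
    (n : Fin d → ℕ) :
    rapidTerm k (a + b) n ≤ (‖a n‖ * (1 + ((∑ i, n i : ℕ) : ℝ)) ^ k +
      ‖b n‖ * (1 + ((∑ i, n i : ℕ) : ℝ)) ^ k) ^ (2 : ℝ) := by
  rw [rapidTerm_eq, ← add_mul]
  have : ‖(a + b) n‖ ≤ ‖a n‖ + ‖b n‖ := norm_add_le _ _
  gcongr

/-- The vector space of rapidly decreasing sequences indexed by `ℕ_0^d`. -/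
def rapidSubmodule : Submodule 𝕜 ((Fin d → ℕ) → 𝕜) where
  carrier := {a | ∀ k : ℕ, Summable (rapidTerm k a)}
  add_mem' := by
    intro a b ha hb k
    have ha := ha k
    have hb := hb k
    simp only [funext (rapidTerm_eq k a)] at ha
    simp only [funext (rapidTerm_eq k b)] at hb
    refine Summable.of_nonneg_of_le (rapidTerm_nonneg k _) (rapidTerm_add_le k a b) ?_
    exact Real.summable_Lp_add_of_nonneg one_le_two
      (fun _ => by positivity) (fun _ => by positivity) ha hb
  zero_mem' := by
    intro k
    have : rapidTerm k (0 : (Fin d → ℕ) → 𝕜) = fun _ => 0 := by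
      funext n; simp [rapidTerm]
    rw [this]
    exact summable_zero
  smul_mem' := by
    intro c a ha k
    have : rapidTerm k (c • a) = fun n => ‖c‖ ^ 2 * rapidTerm k a n := by
      funext n; simp [rapidTerm, mul_pow, mul_assoc]
    rw [this]
    exact (ha k).mul_left _

/-- The space `s` of rapidly decreasing sequences indexed by `ℕ_0^d` (a type synonym, so that it
does not carry the topology of pointwise convergence). -/
def RapidSeq : Type _ := ↥(rapidSubmodule 𝕜 d)

instance : AddCommGroup (RapidSeq 𝕜 d) :=
  inferInstanceAs (AddCommGroup ↥(rapidSubmodule 𝕜 d))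

instance : Module 𝕜 (RapidSeq 𝕜 d) :=
  inferInstanceAs (Module 𝕜 ↥(rapidSubmodule 𝕜 d))

instance : CoeFun (RapidSeq 𝕜 d) (fun _ => (Fin d → ℕ) → 𝕜) := ⟨fun a => a.1⟩

/-- The seminorm `a ↦ (∑_n |a_n|² (1 + |n|)^{2k})^{1/2}`. -/
def rapidSeminorm (k : ℕ) : Seminorm 𝕜 (RapidSeq 𝕜 d) :=
  Seminorm.of (fun a => √(∑' n, rapidTerm k a.1 n))
    (by
      intro a b
      have ha := a.2 k
      have hb := b.2 k
      have hab := (a + b).2 k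
      simp only [funext (rapidTerm_eq k a.1)] at ha
      simp only [funext (rapidTerm_eq k b.1)] at hb
      have hs := Real.summable_Lp_add_of_nonneg one_le_two
        (fun _ => by positivity) (fun _ => by positivity) ha hb
      have hm := Real.Lp_add_le_tsum_of_nonneg' one_le_two
        (fun _ => by positivity) (fun _ => by positivity) ha hb
      have h1 : (∑' n, rapidTerm k (a + b).1 n) ≤ _ :=
        hab.tsum_le_tsum (rapidTerm_add_le k a.1 b.1) hs
      simp only [Real.sqrt_eq_rpow, funext (rapidTerm_eq k a.1), funext (rapidTerm_eq k b.1)]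
      refine le_trans ?_ hm
      exact Real.rpow_le_rpow (tsum_nonneg (rapidTerm_nonneg k _)) h1 (by norm_num))
    (by
      intro c a
      have : rapidTerm k (c • a).1 = fun n => ‖c‖ ^ 2 * rapidTerm k a.1 n := by
        funext n
        change rapidTerm k (c • a.1) n = _
        simp [rapidTerm, mul_pow, mul_assoc]
      rw [this, tsum_mul_left, Real.sqrt_mul (by positivity), Real.sqrt_sq (norm_nonneg c)])

/-- The defining family of seminorms of `s`. -/
def rapidSeminormFamily : SeminormFamily 𝕜 (RapidSeq 𝕜 d) ℕ := rapidSeminorm 𝕜 d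

/-- The locally convex topology of `s`. -/
instance : TopologicalSpace (RapidSeq 𝕜 d) :=
  (rapidSeminormFamily 𝕜 d).moduleFilterBasis.topology'

theorem rapid_withSeminorms : WithSeminorms (rapidSeminormFamily 𝕜 d) := ⟨rfl⟩

end Space

section Laguerre

/-- The Laguerre polynomial `L_n(x) = (e^x / n!) (d/dx)^n (e^{-x} x^n)`. -/
def laguerrePoly (n : ℕ) (x : ℝ) : ℝ :=
  Real.exp x / (n.factorial : ℝ) * iteratedDeriv n (fun t : ℝ => Real.exp (-t) * t ^ n) x

/-- The one-dimensional Laguerre function `𝓛_n(x) = L_n(x) e^{-x/2}`. -/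
def laguerreFun (n : ℕ) (x : ℝ) : ℝ := laguerrePoly n x * Real.exp (-x / 2)

open Polynomial in
theorem laguerreFun_eq (n : ℕ) :
    ∃ P : ℝ[X], ∀ x, laguerreFun n x = P.eval x * Real.exp (-x / 2) := by
  have key : ∀ (m : ℕ) (Q : ℝ[X]), ∃ R : ℝ[X],
      iteratedDeriv m (fun t : ℝ => Real.exp (-t) * Q.eval t) =
        fun t => Real.exp (-t) * R.eval t := by
    intro m
    induction m with
    | zero => exact fun Q => ⟨Q, by simp⟩
    | succ m ih =>
      intro Q
      obtain ⟨R, hR⟩ := ih (derivative Q - Q)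
      refine ⟨R, ?_⟩
      rw [iteratedDeriv_succ', ← hR]
      congr 1
      funext t
      have h1 : HasDerivAt (fun t : ℝ => Real.exp (-t)) (Real.exp (-t) * (-1)) t :=
        (hasDerivAt_neg t).exp
      have h2 : HasDerivAt (fun t : ℝ => Real.exp (-t) * Q.eval t) _ t := h1.mul (Q.hasDerivAt t)
      rw [h2.deriv, eval_sub]
      ring
  obtain ⟨R, hR⟩ := key n (X ^ n)
  refine ⟨C ((n.factorial : ℝ)⁻¹) * R, fun x => ?_⟩
  simp only [eval_pow, eval_X] at hR
  rw [laguerreFun, laguerrePoly, hR, eval_mul, eval_C]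
  have : Real.exp x * Real.exp (-x) = 1 := by rw [← Real.exp_add]; simp
  calc _ = (Real.exp x * Real.exp (-x)) * ((n.factorial : ℝ)⁻¹ * R.eval x * Real.exp (-x / 2)) := by
        rw [div_eq_mul_inv]; ring
    _ = _ := by rw [this, one_mul]

open Polynomial in
theorem bounded_poly_exp (P : ℝ[X]) :
    ∃ C, 0 ≤ C ∧ ∀ x, 0 < x → |P.eval x * Real.exp (-x / 2)| ≤ C := by
  induction P using Polynomial.induction_on' with
  | add p q hp hq =>
    obtain ⟨A, hA0, hA⟩ := hp
    obtain ⟨B, hB0, hB⟩ := hq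
    refine ⟨A + B, by positivity, fun x hx => ?_⟩
    rw [eval_add, add_mul]
    exact (abs_add_le _ _).trans (add_le_add (hA x hx) (hB x hx))
  | monomial n c =>
    refine ⟨|c| * (2 ^ n * n.factorial), by positivity, fun x hx => ?_⟩
    rw [eval_monomial, mul_assoc, abs_mul]
    refine mul_le_mul_of_nonneg_left ?_ (abs_nonneg c)
    rw [abs_of_nonneg (by positivity), neg_div, Real.exp_neg, ← div_eq_mul_inv,
      div_le_iff₀ (Real.exp_pos _)]
    have h := Real.pow_div_factorial_le_exp (x / 2) (by positivity) n
    rw [div_le_iff₀ (by positivity), div_pow, div_le_iff₀ (by positivity)] at h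
    linarith

variable (𝕜 : Type*) [RCLike 𝕜] {d : ℕ}

open Polynomial in
theorem contDiff_eval (P : ℝ[X]) : ContDiff ℝ ∞ (fun x : ℝ => P.eval x) := by
  simpa using P.contDiff_aeval (R := ℝ) (𝕜 := ℝ) ∞

open Polynomial in
/-- Tensor products of polynomials times `e^{-x/2}`. -/
def tensorFun (P : Fin d → ℝ[X]) (x : Fin d → ℝ) : 𝕜 :=
  ((∏ i, ((P i).eval (x i) * Real.exp (-x i / 2)) : ℝ) : 𝕜)

open Polynomial in
theorem contDiff_tensorFun (P : Fin d → ℝ[X]) : ContDiff ℝ ∞ (tensorFun 𝕜 P) := by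
  have h0 : ContDiff ℝ ∞ (RCLike.ofRealCLM (K := 𝕜)) := ContinuousLinearMap.contDiff _
  refine h0.comp (contDiff_prod fun i _ => ?_)
  have h1 : ContDiff ℝ ∞ (fun x : Fin d → ℝ => x i) := contDiff_apply ℝ ℝ i
  exact ((contDiff_eval (P i)).comp h1).mul ((h1.neg.div_const 2).exp)

open Polynomial in
theorem pderiv_tensorFun (j : Fin d) (P : Fin d → ℝ[X]) :
    pderiv j (tensorFun 𝕜 P) =
      tensorFun 𝕜 (Function.update P j (derivative (P j) - C (1 / 2) * P j)) := by
  funext x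
  have hd : DifferentiableAt ℝ (tensorFun 𝕜 P) x :=
    (contDiff_tensorFun 𝕜 P).differentiable (by simp) x
  rw [pderiv, ← hd.lineDeriv_eq_fderiv]
  have h1 : HasDerivAt (fun t : ℝ => (P j).eval (x j + t) * Real.exp (-(x j + t) / 2))
      (((derivative (P j) - C (1 / 2) * P j).eval (x j)) * Real.exp (-x j / 2)) 0 := by
    have ha : HasDerivAt (fun t : ℝ => x j + t) 1 0 := (hasDerivAt_id 0).const_add (x j)
    have hb : HasDerivAt (fun t : ℝ => (P j).eval (x j + t) * Real.exp (-(x j + t) / 2)) _ 0 :=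
      (((P j).hasDerivAt (x j + 0)).comp (0 : ℝ) ha).mul ((ha.neg.div_const 2).exp)
    refine hb.congr_deriv ?_
    simp only [Function.comp_apply, eval_sub, eval_mul, eval_C, add_zero, Pi.neg_apply]
    ring
  have h2 := (RCLike.ofRealCLM (K := 𝕜)).hasFDerivAt.comp_hasDerivAt (0 : ℝ) (h1.mul_const
    (∏ i ∈ Finset.univ.erase j, ((P i).eval (x i) * Real.exp (-x i / 2))))
  have h3 : HasLineDerivAt ℝ (tensorFun 𝕜 P)
      (tensorFun 𝕜 (Function.update P j (derivative (P j) - C (1 / 2) * P j)) x) x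
      (Pi.single j 1) := by
    unfold HasLineDerivAt
    convert h2 using 1
    · funext t
      simp only [tensorFun]
      congr 1
      rw [← Finset.mul_prod_erase _ _ (Finset.mem_univ j)]
      congr 1
      · simp
      · refine Finset.prod_congr rfl fun i hi => ?_
        simp [Finset.ne_of_mem_erase hi]
    · simp only [tensorFun]
      congr 1
      rw [← Finset.mul_prod_erase _ _ (Finset.mem_univ j)]
      congr 1
      · simp
      · refine Finset.prod_congr rfl fun i hi => ?_
        simp [Finset.ne_of_mem_erase hi]
  exact h3.lineDeriv

open Polynomial in
theorem tensorFun_mem (P : Fin d → ℝ[X]) :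
    (orthant d).indicator (tensorFun 𝕜 P) ∈ schwartzSubmodule 𝕜 d := by
  have heq : Set.EqOn ((orthant d).indicator (tensorFun 𝕜 P)) (tensorFun 𝕜 P) (orthant d) :=
    fun x hx => Set.indicator_of_mem hx _
  have key : ∀ p : Fin d → ℕ, ∃ Q : Fin d → ℝ[X],
      Set.EqOn (multiDeriv p ((orthant d).indicator (tensorFun 𝕜 P))) (tensorFun 𝕜 Q)
        (orthant d) := by
    intro p
    refine multiDeriv_induct (P := fun f _ _ => ∃ Q : Fin d → ℝ[X],
      Set.EqOn f (tensorFun 𝕜 Q) (orthant d)) ?_ p (g := 0) (h := 0) ⟨P, heq⟩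
    rintro i f - - ⟨Q, hQ⟩
    exact ⟨_, pderiv_tensorFun 𝕜 i Q ▸ pderiv_congr i hQ⟩
  refine ⟨fun x hx => Set.indicator_of_notMem hx _,
    (contDiff_tensorFun 𝕜 P).contDiffOn.congr heq, fun p => ?_, fun k p => ?_⟩
  · obtain ⟨Q, hQ⟩ := key p
    exact ⟨_, (contDiff_tensorFun 𝕜 Q).continuous.continuousOn, hQ.symm⟩
  · obtain ⟨Q, hQ⟩ := key p
    choose C hC0 hC using fun i => bounded_poly_exp (X ^ k i * Q i)
    refine ⟨∏ i, C i, ?_⟩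
    rintro _ ⟨x, rfl⟩
    simp only
    rw [hQ x.2, tensorFun, RCLike.norm_ofReal, ← abs_of_nonneg (prod_pow_nonneg k x.2), ← abs_mul,
      ← Finset.prod_mul_distrib, Finset.abs_prod]
    refine Finset.prod_le_prod (fun _ _ => abs_nonneg _) fun i _ => ?_
    have := hC i (x.1 i) (x.2 i)
    rwa [eval_mul, eval_pow, eval_X, mul_assoc] at this

/-- The `d`-dimensional Laguerre function `𝓛_n(x) = ∏ᵢ 𝓛_{n_i}(x_i)`, as an element of
`𝒮(ℝ^d_+)`. -/
def laguerre (n : Fin d → ℕ) : SchwartzOrthant 𝕜 d :=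
  ⟨(orthant d).indicator fun x => ((∏ i, laguerreFun (n i) (x i) : ℝ) : 𝕜), by
    choose P hP using fun i => laguerreFun_eq (n i)
    have : (fun x : Fin d → ℝ => ((∏ i, laguerreFun (n i) (x i) : ℝ) : 𝕜)) = tensorFun 𝕜 P := by
      funext x
      simp only [tensorFun, hP]
    rw [this]
    exact tensorFun_mem 𝕜 P⟩

/-- The Laguerre coefficient `a_n(f) = ∫_{ℝ^d_+} f(x) 𝓛_n(x) dx`. -/
def coeff {𝕜 : Type*} [RCLike 𝕜] {d : ℕ} (f : SchwartzOrthant 𝕜 d) (n : Fin d → ℕ) : 𝕜 :=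
  ∫ x in orthant d, f x * laguerre 𝕜 n x

end Laguerre

end LaguerreOrthant

end

noncomputable section

/-! The Laguerre functions are eigenvectors of a symmetric differential operator, and this turns
regularity of `f` into decay of its coefficients. The operator `-∂_i x_i ∂_i + x_i / 4` maps `𝓛_n`
to `(n_i + 1/2) 𝓛_n`. It is symmetric for the pairing `∫ f g`, without boundary terms, because the
factor `x_i` between the two derivatives vanishes on the face `x_i = 0`. Summing over `i` and
shifting by a constant gives an operator with eigenvalue `1 + |n|`. Applying it `k` times under the
integral bounds `(1 + |n|)^k |a_n(f)|` by a continuous seminorm of `f` (`exists_coeff_bound`).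

In the other direction, every continuous seminorm grows at most polynomially along `𝓛_n`
(`polyGrowth_of_continuous`). The start is a sup bound, obtained from orthonormality and the
fundamental theorem of calculus (`abs_laguerreFun_le`). The three-term recurrence and `L_n' =
-∑_{j<n} L_j` then show that each multiplication by `x_i` and each `∂_i` costs one power of `1 +
|n|`. Hence a series with rapidly decreasing coefficients converges absolutely, and it has a sum
because `𝒮(ℝ^d_+)` is complete (`exists_hasSum_of_summable_seminorms`). By orthonormality the sum
has the prescribed coefficients.

It remains to see that the coefficients determine `f` (`eq_zero_of_coeff_eq_zero`). The generating
function expands `e^{-x/2 - iξx}` into Laguerre functions with geometrically decreasing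
coefficients. If all `a_n(f)` vanish, then so does the Fourier transform of `f(x) e^{-(x_1 + ⋯ +
x_d)/2}`, extended by zero, and Fourier inversion gives `f = 0`. The expansion of `f` and the
surjectivity of `ι` follow. Both directions are continuous because all bounds are explicit in
seminorms. -/

namespace LaguerreOrthant

/-! ### Algebraic identities for Laguerre polynomials. -/

section LaguerrePolynomial

open Polynomial

/-- The Laguerre polynomial `∑ₖ (n choose k) (-X)^k / k!`. -/
def laguerreP (n : ℕ) : ℝ[X] :=
  ∑ k ∈ Finset.range (n + 1), monomial k ((n.choose k : ℝ) * (-1) ^ k / (k.factorial : ℝ))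

/-- Since the binomial coefficient vanishes for `k > n`, the formula needs no range condition, and
polynomial identities can be checked coefficient by coefficient. -/
theorem coeff_laguerreP (n k : ℕ) :
    (laguerreP n).coeff k = (n.choose k : ℝ) * (-1) ^ k / (k.factorial : ℝ) := by
  simp only [laguerreP, finsetSum_coeff, coeff_monomial, Finset.sum_ite_eq', Finset.mem_range]
  split_ifs with h
  · rfl
  · rw [Nat.choose_eq_zero_of_lt (by omega)]; simp

theorem eval_laguerreP (n : ℕ) (x : ℝ) : (laguerreP n).eval x =
    ∑ k ∈ Finset.range (n + 1), (n.choose k : ℝ) * (-1) ^ k / (k.factorial : ℝ) * x ^ k := by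
  simp [laguerreP, eval_finsetSum, eval_monomial]

/-- Leibniz's rule for `e^{-t} t^n`: the `(n - k)`-th derivative of `t^n` is `(n! / k!) t^k`. -/
theorem laguerreFun_eq_eval (n : ℕ) (x : ℝ) :
    laguerreFun n x = (laguerreP n).eval x * Real.exp (-x / 2) := by
  have h1 : ContDiffAt ℝ n (fun t : ℝ => Real.exp (-t)) x := by fun_prop
  have h2 : ContDiffAt ℝ n (fun t : ℝ => t ^ n) x := by fun_prop
  have h3 : ∀ i, iteratedDeriv i (fun t : ℝ => Real.exp (-t)) x = (-1) ^ i * Real.exp (-x) := by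
    intro i
    have := iteratedDeriv_comp_neg i Real.exp x
    rw [this, iteratedDeriv_eq_iterate, Real.iter_deriv_exp, smul_eq_mul]
  rw [laguerreFun, laguerrePoly, iteratedDeriv_fun_mul h1 h2, eval_laguerreP, Finset.mul_sum]
  congr 1
  refine Finset.sum_congr rfl fun k hk => ?_
  have hk' : k ≤ n := by simpa [Nat.lt_succ_iff] using hk
  rw [h3, iteratedDeriv_pow, Nat.sub_sub_self hk']
  have hd : (n.descFactorial (n - k) : ℝ) * k.factorial = n.factorial := by
    have := Nat.factorial_mul_descFactorial (Nat.sub_le n k)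
    rw [Nat.sub_sub_self hk'] at this
    rw [mul_comm]; exact_mod_cast this
  have he : Real.exp x * Real.exp (-x) = 1 := by rw [← Real.exp_add]; simp
  have hk0 : (k.factorial : ℝ) ≠ 0 := by positivity
  have hn0 : (n.factorial : ℝ) ≠ 0 := by positivity
  field_simp
  linear_combination (x ^ k * (n.choose k : ℝ)) * (hd + n.descFactorial (n - k) * k.factorial * he)

/-- The subtraction is in `ℝ`, so the identity holds for all `k`; both sides are zero when `k > n`.
-/
theorem succ_mul_choose_cast (n k : ℕ) :
    ((k : ℝ) + 1) * (n.choose (k + 1) : ℝ) = ((n : ℝ) - k) * (n.choose k : ℝ) := by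
  rcases le_or_gt k n with h | h
  · have := Nat.choose_succ_right_eq n k
    rw [← Nat.cast_sub h]
    have : ((n.choose (k + 1) * (k + 1) : ℕ) : ℝ) = ((n.choose k * (n - k) : ℕ) : ℝ) := by rw [this]
    push_cast at this
    linarith
  · rw [Nat.choose_eq_zero_of_lt h, Nat.choose_eq_zero_of_lt (by omega)]; simp

/-- Pascal's rule on coefficients; summed over `n` it telescopes to `derivative_laguerreP`. -/
theorem derivative_laguerreP_succ (n : ℕ) :
    derivative (laguerreP (n + 1)) = derivative (laguerreP n) - laguerreP n := by
  ext k
  rw [coeff_sub, coeff_derivative, coeff_derivative]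
  simp only [coeff_laguerreP, Nat.choose_succ_succ', Nat.factorial_succ]
  push_cast
  have hk0 : (k.factorial : ℝ) ≠ 0 := by positivity
  field_simp
  ring

theorem laguerreP_ode (n : ℕ) :
    X * derivative (derivative (laguerreP n)) + (1 - X) * derivative (laguerreP n)
      + C (n : ℝ) * laguerreP n = 0 := by
  ext k
  have h := succ_mul_choose_cast n k
  have hk0 : (k.factorial : ℝ) ≠ 0 := by positivity
  rcases k with _ | k
  · simp only [sub_mul, one_mul, coeff_add, coeff_sub, coeff_C_mul, coeff_X_mul_zero,
      coeff_derivative, coeff_laguerreP, coeff_zero]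
    simp at h ⊢
  · simp only [sub_mul, one_mul, coeff_add, coeff_sub, coeff_C_mul, coeff_X_mul,
      coeff_derivative, coeff_laguerreP, coeff_zero]
    rw [Nat.factorial_succ (k + 1)]
    push_cast at h ⊢
    field_simp
    linear_combination ((-1 : ℝ) ^ k) * h

/-- Pascal's rule and the absorption identity for binomial coefficients. At `n = 0` the truncated
index `n - 1` is harmless, because its coefficient is zero. -/
theorem X_mul_laguerreP (n : ℕ) :
    X * laguerreP n = -C ((n : ℝ) + 1) * laguerreP (n + 1) + C (2 * (n : ℝ) + 1) * laguerreP n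
      - C (n : ℝ) * laguerreP (n - 1) := by
  ext k
  simp only [neg_mul, coeff_add, coeff_neg, coeff_sub, coeff_C_mul, coeff_laguerreP]
  rcases k with _ | k
  · simp; ring
  · rw [coeff_X_mul, coeff_laguerreP]
    have hk0 : (k.factorial : ℝ) ≠ 0 := by positivity
    have h1 := succ_mul_choose_cast n k
    have h2 : (n : ℝ) * ((n - 1).choose (k + 1) : ℝ)
        = ((n : ℝ) - k - 1) * (n.choose (k + 1) : ℝ) := by
      rcases n with _ | n
      · simp
      · have := Nat.add_one_mul_choose_eq n k
        have h3 : ((n : ℝ) + 1) * n.choose k = (n.choose k + n.choose (k + 1) : ℕ) * (k + 1) := by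
          rw [← Nat.choose_succ_succ']; exact_mod_cast this
        simp only [Nat.add_sub_cancel, Nat.choose_succ_succ']
        push_cast at h3 ⊢
        linarith
    rw [Nat.factorial_succ, Nat.choose_succ_succ']
    push_cast
    field_simp
    rw [pow_succ]
    linear_combination ((-1 : ℝ) ^ k) * h1 + (-(-1 : ℝ) ^ k) * h2

theorem derivative_laguerreP (n : ℕ) :
    derivative (laguerreP n) = -∑ j ∈ Finset.range n, laguerreP j := by
  induction n with
  | zero => simp [laguerreP]
  | succ n ih => rw [derivative_laguerreP_succ, ih, Finset.sum_range_succ]; ring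

end LaguerrePolynomial

/-! ### Orthonormality and the pointwise bound on the half-line. -/

section ExpFunctional

open Polynomial MeasureTheory

/-- The linear functional `P ↦ ∫₀^∞ P(x) e^{-x} dx` on polynomials. -/
def expFunctional : ℝ[X] →ₗ[ℝ] ℝ := Polynomial.lsum fun k => (k.factorial : ℝ) • LinearMap.id

theorem expFunctional_monomial (k : ℕ) (c : ℝ) :
    expFunctional (monomial k c) = k.factorial * c := by
  simp [expFunctional, Polynomial.lsum_apply, sum_monomial_index]

/-- Integration by parts against `e^{-x}`; on monomials it is just `(n + 1)! = (n + 1) n!`. -/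
theorem expFunctional_derivative (P : ℝ[X]) :
    expFunctional (derivative P) = expFunctional P - P.eval 0 := by
  induction P using Polynomial.induction_on' with
  | add p q hp hq => simp only [map_add, hp, hq, eval_add]; ring
  | monomial n c =>
    rw [derivative_monomial, expFunctional_monomial, expFunctional_monomial, eval_monomial]
    rcases n with _ | n
    · simp
    · simp [Nat.factorial_succ]; ring

theorem integrableOn_eval_mul_exp (P : ℝ[X]) :
    IntegrableOn (fun x : ℝ => P.eval x * Real.exp (-x)) (Set.Ioi 0) ∧
    ∫ x in Set.Ioi (0 : ℝ), P.eval x * Real.exp (-x) = expFunctional P := by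
  induction P using Polynomial.induction_on' with
  | add p q hp hq =>
    simp only [eval_add, add_mul, map_add]
    exact ⟨hp.1.add hq.1, by rw [integral_add hp.1 hq.1, hp.2, hq.2]⟩
  | monomial n c =>
    have h1 := Real.GammaIntegral_convergent (s := n + 1) (by positivity)
    have h2 := Real.Gamma_eq_integral (s := n + 1) (by positivity)
    rw [Real.Gamma_nat_eq_factorial] at h2
    simp only [add_sub_cancel_right, Real.rpow_natCast] at h1 h2
    have h3 : ∀ x : ℝ, (monomial n c).eval x * Real.exp (-x) = c * (Real.exp (-x) * x ^ n) := by
      intro x; rw [eval_monomial]; ring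
    simp only [h3]
    refine ⟨h1.const_mul c, ?_⟩
    rw [integral_const_mul, ← h2, expFunctional_monomial, mul_comm]

/-- The Laguerre equation in Sturm–Liouville form, `-(x e^{-x} L_n')' = n e^{-x} L_n`, integrated
against `R`. The factor `X` removes the boundary term at zero. For `R = L_m` the right side is
symmetric in `n` and `m`, which yields orthogonality. -/
theorem expFunctional_ode (n : ℕ) (R : ℝ[X]) :
    (n : ℝ) * expFunctional (laguerreP n * R)
      = expFunctional (X * derivative (laguerreP n) * derivative R) := by
  have h := expFunctional_derivative (X * derivative (laguerreP n) * R)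
  have h2 : derivative (X * derivative (laguerreP n) * R) = X * derivative (laguerreP n) * R
      - (n : ℝ) • (laguerreP n * R) + X * derivative (laguerreP n) * derivative R := by
    have := laguerreP_ode n
    simp only [derivative_mul, derivative_X, one_mul, smul_eq_C_mul]
    linear_combination R * this
  rw [h2, map_add, map_sub, map_smul] at h
  simp at h
  linarith

theorem expFunctional_laguerreP_of_ne {n m : ℕ} (h : n ≠ m) :
    expFunctional (laguerreP n * laguerreP m) = 0 := by
  have h1 := expFunctional_ode n (laguerreP m)
  have h2 := expFunctional_ode m (laguerreP n)
  rw [mul_comm (laguerreP m), mul_right_comm, ← h1] at h2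
  have h3 : ((n : ℝ) - m) * expFunctional (laguerreP n * laguerreP m) = 0 := by linarith
  rcases mul_eq_zero.1 h3 with h4 | h4
  · exact absurd (by exact_mod_cast sub_eq_zero.1 h4) h
  · exact h4

theorem expFunctional_laguerreP_self (n : ℕ) :
    expFunctional (laguerreP n * laguerreP n) = 1 := by
  induction n with
  | zero =>
    have : laguerreP 0 * laguerreP 0 = monomial 0 1 := by simp [laguerreP]
    rw [this, expFunctional_monomial]; simp
  | succ n ih =>
    -- The value of `expFunctional` on `X L_n L_{n+1}` is computed twice, by the recurrence for `X
    -- L_n` and by that for `X L_{n+1}`. Orthogonality leaves the squares of `L_{n+1}` and `L_n`,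
    -- each with the factor `-(n + 1)`, so the two norms agree.
    have h1 := congrArg (fun P => expFunctional (P * laguerreP (n + 1))) (X_mul_laguerreP n)
    have h2 := congrArg (fun P => expFunctional (laguerreP n * P)) (X_mul_laguerreP (n + 1))
    simp only [Nat.add_sub_cancel] at h1 h2
    have e1 : ∀ a b c : ℝ, ∀ P Q R S : ℝ[X], expFunctional ((-C a * P + C b * Q - C c * R) * S)
        = -a * expFunctional (P * S) + b * expFunctional (Q * S) - c * expFunctional (R * S) := by
      intro a b c P Q R S
      have : (-C a * P + C b * Q - C c * R) * S = (-a) • (P * S) + b • (Q * S) - c • (R * S) := by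
        simp only [smul_eq_C_mul, C_neg]; ring
      rw [this, map_sub, map_add, map_smul, map_smul, map_smul]; rfl
    rw [e1] at h1
    rw [mul_comm (laguerreP n) (_ - _), e1] at h2
    have e2 : X * laguerreP n * laguerreP (n + 1) = laguerreP n * (X * laguerreP (n + 1)) := by ring
    rw [e2, h2, ih, expFunctional_laguerreP_of_ne (by omega : n ≠ n + 1),
      expFunctional_laguerreP_of_ne (by omega : n + 1 ≠ n),
      expFunctional_laguerreP_of_ne (by omega : n + 1 + 1 ≠ n)] at h1
    have h0 : (n : ℝ) * expFunctional (laguerreP (n - 1) * laguerreP (n + 1)) = 0 := by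
      rw [expFunctional_laguerreP_of_ne (by omega)]; simp
    rw [h0] at h1
    push_cast at h1
    have : ((n : ℝ) + 1) * (expFunctional (laguerreP (n + 1) * laguerreP (n + 1)) - 1) = 0 := by
      linarith
    rcases mul_eq_zero.1 this with h | h
    · exact absurd h (by positivity)
    · linarith

theorem expFunctional_laguerreP (n m : ℕ) :
    expFunctional (laguerreP n * laguerreP m) = if n = m then 1 else 0 := by
  split_ifs with h
  · rw [h, expFunctional_laguerreP_self]
  · exact expFunctional_laguerreP_of_ne h

/-- By `derivative_laguerreP` the polynomial squared is `-(∑_{j<n} L_j + L_n / 2)`, and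
orthonormality gives `n + 1/4`. It is the squared `L²` norm of `𝓛_n'`. -/
theorem expFunctional_derivative_sq (n : ℕ) :
    expFunctional ((derivative (laguerreP n) - C (1 / 2) * laguerreP n) ^ 2) = n + 1 / 4 := by
  have h1 : (derivative (laguerreP n) - C (1 / 2) * laguerreP n) ^ 2 =
      ∑ i ∈ Finset.range n, ∑ j ∈ Finset.range n, laguerreP i * laguerreP j
      + ∑ i ∈ Finset.range n, laguerreP i * laguerreP n
      + (1 / 4 : ℝ) • (laguerreP n * laguerreP n) := by
    rw [derivative_laguerreP, ← Finset.sum_mul_sum, ← Finset.sum_mul, smul_eq_C_mul]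
    have h2 : (C (1 / 4) : ℝ[X]) = C (1 / 2) * C (1 / 2) := by rw [← C_mul]; norm_num
    have h3 : (2 : ℝ[X]) * C (1 / 2) = 1 := by
      rw [← C_1, ← map_ofNat (C : ℝ →+* ℝ[X]) 2, ← C_mul]; norm_num
    rw [h2]
    linear_combination ((∑ i ∈ Finset.range n, laguerreP i) * laguerreP n) * h3
  rw [h1]
  simp only [map_add, map_sum, map_smul, expFunctional_laguerreP]
  have : ∀ x ∈ Finset.range n, (if x = n then (1 : ℝ) else 0) = 0 := fun x hx => by
    simp at hx; rw [if_neg (by omega)]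
  rw [Finset.sum_congr rfl this]
  have h2 : ∀ x ∈ Finset.range n,
      (∑ j ∈ Finset.range n, if x = j then (1 : ℝ) else 0) = 1 := fun x hx => by
    rw [Finset.sum_ite_eq, if_pos hx]
  rw [Finset.sum_congr rfl h2]
  simp

/-- The pointwise bound `|𝓛_n| ≤ n + 2` on the half-line. -/
theorem abs_laguerreFun_le (n : ℕ) {x : ℝ} (hx : 0 < x) : |laguerreFun n x| ≤ n + 2 := by
  set P := laguerreP n
  -- `R e^{-t/2}` is the derivative of `P e^{-t/2}`.
  set R := derivative P - C (1 / 2) * P with hR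
  have hder : ∀ t : ℝ, HasDerivAt (fun t => (P ^ 2).eval t * Real.exp (-t))
      ((2 * P * R).eval t * Real.exp (-t)) t := by
    intro t
    refine (((P ^ 2).hasDerivAt t).mul (hasDerivAt_neg t).exp).congr_deriv ?_
    simp [hR, derivative_pow]
    ring
  have hint := integrableOn_eval_mul_exp (2 * P * R)
  have hlim : Filter.Tendsto (fun t => (P ^ 2).eval t * Real.exp (-t)) Filter.atTop (nhds 0) := by
    refine (Polynomial.tendsto_div_exp_atTop (P ^ 2)).congr fun t => ?_
    rw [Real.exp_neg, div_eq_mul_inv]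
  have hsub : IntegrableOn (fun t => (2 * P * R).eval t * Real.exp (-t)) (Set.Ioi x) :=
    hint.1.mono_set (Set.Ioi_subset_Ioi hx.le)
  have h1 := integral_Ioi_of_hasDerivAt_of_tendsto' (fun t _ => hder t) hsub hlim
  have hint2 := integrableOn_eval_mul_exp (P ^ 2 + R ^ 2)
  -- `P(x)² e^{-x}` is minus the integral of its derivative over `(x, ∞)`, and `-2PR ≤ P² + R²`.
  -- Enlarging the domain to `(0, ∞)` gives the sum of the squared norms of `𝓛_n` and `𝓛_n'`.
  have h2 : (P ^ 2).eval x * Real.exp (-x) ≤ expFunctional (P ^ 2 + R ^ 2) := by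
    rw [← hint2.2]
    have h3 : (P ^ 2).eval x * Real.exp (-x)
        = ∫ t in Set.Ioi x, -((2 * P * R).eval t * Real.exp (-t)) := by
      rw [integral_neg, h1]; ring
    rw [h3]
    calc _ ≤ ∫ t in Set.Ioi x, (P ^ 2 + R ^ 2).eval t * Real.exp (-t) := by
          refine integral_mono hsub.neg (hint2.1.mono_set (Set.Ioi_subset_Ioi hx.le)) fun t => ?_
          simp only [← neg_mul]
          refine mul_le_mul_of_nonneg_right ?_ (Real.exp_pos _).le
          simp only [eval_mul, eval_add, eval_pow, eval_ofNat]
          nlinarith [sq_nonneg (P.eval t + R.eval t)]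
      _ ≤ _ := by
          refine setIntegral_mono_set hint2.1 (Filter.Eventually.of_forall fun t => ?_)
            (Set.Ioi_subset_Ioi hx.le).eventuallyLE
          simp only [eval_add, eval_pow, Pi.zero_apply]
          positivity
  rw [map_add, hR, expFunctional_derivative_sq, pow_two, expFunctional_laguerreP_self] at h2
  have h4 : laguerreFun n x ^ 2 = (P * P).eval x * Real.exp (-x) := by
    rw [laguerreFun_eq_eval, mul_pow, ← Real.exp_nat_mul, eval_mul, pow_two]
    congr 2
    push_cast; ring
  refine abs_le_of_sq_le_sq ?_ (by positivity)
  rw [h4]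
  -- The bound obtained is `1 + n + 1/4`, which is at most `(n + 2)²`.
  nlinarith [h2, (Nat.cast_nonneg n : (0 : ℝ) ≤ n)]

theorem integrableOn_laguerreFun_mul (n m : ℕ) :
    IntegrableOn (fun x => laguerreFun n x * laguerreFun m x) (Set.Ioi 0) ∧
    ∫ x in Set.Ioi (0 : ℝ), laguerreFun n x * laguerreFun m x = if n = m then 1 else 0 := by
  have h : ∀ x, laguerreFun n x * laguerreFun m x
      = (laguerreP n * laguerreP m).eval x * Real.exp (-x) := by
    intro x
    have : Real.exp (-x) = Real.exp (-x / 2) * Real.exp (-x / 2) := by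
      rw [← Real.exp_add]; ring_nf
    rw [laguerreFun_eq_eval, laguerreFun_eq_eval, eval_mul, this]; ring
  simp only [h, ← expFunctional_laguerreP]
  exact integrableOn_eval_mul_exp _

end ExpFunctional

/-! ### Iterated partial derivatives on the orthant. -/

section DerivativeCalculus

variable {𝕜 : Type*} [RCLike 𝕜] {d : ℕ}

theorem multiDeriv_zero_index (f : (Fin d → ℝ) → 𝕜) : multiDeriv 0 f = f := by
  simp [multiDeriv]

theorem contDiffOn_multiDeriv (p : Fin d → ℕ) {f : (Fin d → ℝ) → 𝕜}
    (hf : ContDiffOn ℝ ∞ f (orthant d)) : ContDiffOn ℝ ∞ (multiDeriv p f) (orthant d) :=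
  multiDeriv_induct (P := fun f _ _ => ContDiffOn ℝ ∞ f (orthant d))
    (fun i _ _ _ h => contDiffOn_pderiv i h) p (g := f) (h := f) hf

theorem multiDeriv_congr (p : Fin d → ℕ) {f g : (Fin d → ℝ) → 𝕜}
    (h : Set.EqOn f g (orthant d)) : Set.EqOn (multiDeriv p f) (multiDeriv p g) (orthant d) :=
  multiDeriv_induct (P := fun f g _ => Set.EqOn f g (orthant d))
    (fun i _ _ _ h => pderiv_congr i h) p (h := f) h

theorem pderiv_comm (i j : Fin d) {f : (Fin d → ℝ) → 𝕜} (hf : ContDiffOn ℝ ∞ f (orthant d)) :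
    Set.EqOn (pderiv i (pderiv j f)) (pderiv j (pderiv i f)) (orthant d) := by
  intro x hx
  have hfx : ContDiffAt ℝ ∞ f x := hf.contDiffAt ((isOpen_orthant d).mem_nhds hx)
  have hsymm : IsSymmSndFDerivAt ℝ f x := hfx.isSymmSndFDerivAt (by simpa using WithTop.coe_le_coe.2 (le_top : (2 : ℕ∞) ≤ ⊤))
  have hd : DifferentiableAt ℝ (fderiv ℝ f) x :=
    (hfx.fderiv_right (m := 1) (by norm_cast)).differentiableAt (by simp)
  have key : ∀ v w : Fin d → ℝ, fderiv ℝ (fun y => fderiv ℝ f y v) x w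
      = fderiv ℝ (fderiv ℝ f) x w v := by
    intro v w
    rw [fderiv_clm_apply hd (differentiableAt_const v)]
    simp
  exact (key _ _).trans ((hsymm.eq _ _).trans (key _ _).symm)

theorem multiDeriv_pderiv (p : Fin d → ℕ) (i : Fin d) {f : (Fin d → ℝ) → 𝕜}
    (hf : ContDiffOn ℝ ∞ f (orthant d)) :
    Set.EqOn (multiDeriv p (pderiv i f)) (pderiv i (multiDeriv p f)) (orthant d) := by
  refine (multiDeriv_induct (P := fun f g _ => ContDiffOn ℝ ∞ f (orthant d) ∧
    Set.EqOn g (pderiv i f) (orthant d)) ?_ p (h := f) ⟨hf, fun _ _ => rfl⟩).2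
  rintro j f g - ⟨hf, hg⟩
  exact ⟨contDiffOn_pderiv j hf, (pderiv_congr j hg).trans (pderiv_comm j i hf)⟩

theorem iterate_pderiv_comm (i j : Fin d) (m : ℕ) {f g : (Fin d → ℝ) → 𝕜}
    (hf : ContDiffOn ℝ ∞ f (orthant d)) (hg : Set.EqOn g (pderiv i f) (orthant d)) :
    ContDiffOn ℝ ∞ ((pderiv j)^[m] f) (orthant d) ∧
    Set.EqOn ((pderiv j)^[m] g) (pderiv i ((pderiv j)^[m] f)) (orthant d) := by
  induction m with
  | zero => exact ⟨hf, hg⟩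
  | succ m ih =>
    simp only [Function.iterate_succ_apply']
    exact ⟨contDiffOn_pderiv j ih.1, (pderiv_congr j ih.2).trans (pderiv_comm j i ih.1)⟩

/-- `multiDeriv` applies the partial derivatives in a fixed order, so the additional `∂_i` arises in
the middle and has to be commuted outwards. The induction runs over duplicate-free lists, so that
`i` is met only once. -/
theorem multiDeriv_add_single (p : Fin d → ℕ) (i : Fin d) {f : (Fin d → ℝ) → 𝕜}
    (hf : ContDiffOn ℝ ∞ f (orthant d)) :
    Set.EqOn (multiDeriv (p + Pi.single i 1) f) (pderiv i (multiDeriv p f)) (orthant d) := by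
  have key : ∀ l : List (Fin d), l.Nodup →
      ContDiffOn ℝ ∞ (l.foldr (fun i g => (pderiv i)^[p i] g) f) (orthant d) ∧
      (i ∉ l → l.foldr (fun j g => (pderiv j)^[(p + Pi.single i 1 : Fin d → ℕ) j] g) f
        = l.foldr (fun i g => (pderiv i)^[p i] g) f) ∧
      (i ∈ l → Set.EqOn (l.foldr (fun j g => (pderiv j)^[(p + Pi.single i 1 : Fin d → ℕ) j] g) f)
        (pderiv i (l.foldr (fun i g => (pderiv i)^[p i] g) f)) (orthant d)) := by
    intro l
    induction l with
    | nil => exact fun _ => ⟨hf, fun _ => rfl, fun h => absurd h (by simp)⟩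
    | cons j l ih =>
      intro hl
      obtain ⟨hj, hl⟩ := List.nodup_cons.1 hl
      obtain ⟨h1, h2, h3⟩ := ih hl
      simp only [List.foldr_cons]
      refine ⟨(iterate_pderiv_comm j j (p j) h1 (fun _ _ => rfl)).1, fun hi => ?_, fun hi => ?_⟩
      · simp only [List.mem_cons, not_or] at hi
        rw [h2 hi.2]
        simp [Pi.single_eq_of_ne (Ne.symm hi.1)]
      · by_cases hij : j = i
        · subst hij
          rw [h2 hj]
          simp only [Pi.add_apply, Pi.single_eq_same, Function.iterate_succ_apply']
          exact fun _ _ => rfl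
        · have hi' : i ∈ l := by
            rcases List.mem_cons.1 hi with h | h
            · exact absurd h.symm hij
            · exact h
          simp only [Pi.add_apply, Pi.single_eq_of_ne hij, add_zero]
          exact (iterate_pderiv_comm i j (p j) h1 (h3 hi')).2
  exact (key (List.finRange d) (List.nodup_finRange d)).2.2 (List.mem_finRange i)

/-- Induction on `|p|`, to raise one exponent at a time. -/
theorem multiIndex_induction {P : (Fin d → ℕ) → Prop} (h0 : P 0)
    (hs : ∀ p i, P p → P (p + Pi.single i 1)) (p : Fin d → ℕ) : P p := by
  induction h : ∑ i, p i generalizing p with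
  | zero =>
    have : p = 0 := by
      funext i
      exact (Finset.sum_eq_zero_iff.1 h) i (Finset.mem_univ i)
    rwa [this]
  | succ m ih =>
    obtain ⟨i, hi⟩ : ∃ i, p i ≠ 0 := by
      by_contra! hc
      simp [hc] at h
    have hp : p = (p - Pi.single i 1) + Pi.single i 1 := by
      funext j
      by_cases hj : j = i
      · subst hj; simp; omega
      · simp [Pi.single_eq_of_ne hj]
    rw [hp]
    refine hs _ _ (ih _ ?_)
    rw [hp] at h
    simp only [Pi.add_apply, Finset.sum_add_distrib, Finset.sum_pi_single', Finset.mem_univ,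
      if_true] at h
    exact Nat.succ_injective h

theorem pderiv_coord_mul (i j : Fin d) {f : (Fin d → ℝ) → 𝕜} {x : Fin d → ℝ}
    (hf : DifferentiableAt ℝ f x) :
    pderiv j (fun y => (y i : 𝕜) * f y) x
      = (x i : 𝕜) * pderiv j f x + (if j = i then f x else 0) := by
  have h1 : HasFDerivAt (fun y : Fin d → ℝ => (y i : 𝕜))
      ((RCLike.ofRealCLM (K := 𝕜)).comp (ContinuousLinearMap.proj i)) x :=
    ((RCLike.ofRealCLM (K := 𝕜)).comp
      (ContinuousLinearMap.proj (R := ℝ) (φ := fun _ : Fin d => ℝ) i)).hasFDerivAt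
  have h2 := h1.mul hf.hasFDerivAt
  have h3 : fderiv ℝ (fun y : Fin d → ℝ => (y i : 𝕜) * f y) x = _ := h2.fderiv
  simp only [pderiv]
  rw [h3]
  by_cases h : j = i
  · subst h; simp
  · simp [h]

theorem contDiffOn_coord_mul (i : Fin d) {f : (Fin d → ℝ) → 𝕜}
    (hf : ContDiffOn ℝ ∞ f (orthant d)) :
    ContDiffOn ℝ ∞ (fun y => (y i : 𝕜) * f y) (orthant d) := by
  refine ContDiffOn.mul (ContDiff.contDiffOn ?_) hf
  exact ((RCLike.ofRealCLM (K := 𝕜)).comp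
      (ContinuousLinearMap.proj (R := ℝ) (φ := fun _ : Fin d => ℝ) i)).contDiff

/-- Leibniz's rule stops after two terms because `x_i` is linear. -/
theorem multiDeriv_coord_mul (i : Fin d) {f : (Fin d → ℝ) → 𝕜}
    (hf : ContDiffOn ℝ ∞ f (orthant d)) (p : Fin d → ℕ) :
    Set.EqOn (multiDeriv p fun y => (y i : 𝕜) * f y)
      (fun x => (x i : 𝕜) * multiDeriv p f x + (p i : 𝕜) * multiDeriv (p - Pi.single i 1) f x)
      (orthant d) := by
  induction p using multiIndex_induction with
  | h0 => intro x _; simp [multiDeriv_zero_index]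
  | hs p j ih =>
    refine (multiDeriv_add_single p j (contDiffOn_coord_mul i hf)).trans fun x hx => ?_
    have hd : ∀ q : Fin d → ℕ, DifferentiableAt ℝ (multiDeriv q f) x := fun q =>
      differentiableAt_of_contDiffOn (contDiffOn_multiDeriv q hf) hx
    have hd1 : DifferentiableAt ℝ (fun y : Fin d → ℝ => (y i : 𝕜) * multiDeriv p f y) x :=
      differentiableAt_of_contDiffOn (contDiffOn_coord_mul i (contDiffOn_multiDeriv p hf)) hx
    rw [pderiv_congr j ih hx]
    have h1 : pderiv j (fun x => (x i : 𝕜) * multiDeriv p f x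
        + (p i : 𝕜) * multiDeriv (p - Pi.single i 1) f x) x
        = pderiv j (fun x => (x i : 𝕜) * multiDeriv p f x) x
          + (p i : 𝕜) * pderiv j (multiDeriv (p - Pi.single i 1) f) x := by
      simp only [pderiv]
      rw [fderiv_fun_add hd1 ((hd _).const_mul _), fderiv_const_mul (hd _)]
      simp
    rw [h1, pderiv_coord_mul i j (hd p), multiDeriv_add_single p j hf hx,
      ← multiDeriv_add_single (p - Pi.single i 1) j hf hx]
    by_cases hj : j = i
    · subst hj
      simp only [if_true, Pi.add_apply, Pi.single_eq_same, add_tsub_cancel_right]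
      -- If `p j = 0`, the truncated `p - Pi.single j 1` is the wrong index, but its coefficient is
      -- zero.
      rcases Nat.eq_zero_or_pos (p j) with h0 | h0
      · simp [h0]
      · have : p - Pi.single j 1 + Pi.single j 1 = p := by
          funext l
          by_cases hl : l = j
          · subst hl; simp; omega
          · simp [Pi.single_eq_of_ne hl]
        rw [this]
        push_cast
        ring
    · have : p + Pi.single j 1 - Pi.single i 1 = p - Pi.single i 1 + Pi.single j 1 := by
        funext l
        by_cases hl : l = i
        · subst hl; simp [Pi.single_eq_of_ne (Ne.symm hj)]
        · simp [Pi.single_eq_of_ne hl]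
      rw [this]
      simp [hj]

theorem fderiv_eq_sum_pderiv (f : (Fin d → ℝ) → 𝕜) (x : Fin d → ℝ) :
    fderiv ℝ f x = ∑ i, (ContinuousLinearMap.proj (R := ℝ) (φ := fun _ : Fin d => ℝ) i).smulRight
      (pderiv i f x) := by
  ext v
  simp only [_root_.sum_apply, ContinuousLinearMap.smulRight_apply,
    ContinuousLinearMap.proj_apply, pderiv]
  conv_lhs => rw [← Finset.univ_sum_single v]
  rw [map_sum]
  refine Finset.sum_congr rfl fun i _ => ?_
  rw [← map_smul, ← Pi.single_smul, smul_eq_mul, mul_one]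

theorem norm_fderiv_le_sum_pderiv (f : (Fin d → ℝ) → 𝕜) (x : Fin d → ℝ) :
    ‖fderiv ℝ f x‖ ≤ ∑ i, ‖pderiv i f x‖ := by
  rw [fderiv_eq_sum_pderiv]
  refine (norm_sum_le _ _).trans (Finset.sum_le_sum fun i _ => ?_)
  refine ContinuousLinearMap.opNorm_le_bound _ (norm_nonneg _) fun v => ?_
  rw [ContinuousLinearMap.smulRight_apply, norm_smul, mul_comm]
  exact mul_le_mul_of_nonneg_left (norm_le_pi_norm v i) (norm_nonneg _)

theorem convex_orthant (d : ℕ) : Convex ℝ (orthant d) := by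
  have : orthant d = Set.univ.pi fun _ => Set.Ioi (0 : ℝ) := by
    ext x; simp [orthant]
  rw [this]
  exact convex_pi fun i _ => convex_Ioi 0

/-- A bounded gradient on the convex orthant makes the function Lipschitz there, and a Lipschitz
function extends to the whole space. -/
theorem exists_continuousOn_extension {g : (Fin d → ℝ) → 𝕜}
    (hg : ContDiffOn ℝ ∞ g (orthant d))
    (hb : ∀ i, ∃ C, ∀ x ∈ orthant d, ‖pderiv i g x‖ ≤ C) :
    ∃ u : (Fin d → ℝ) → 𝕜, ContinuousOn u (closedOrthant d) ∧ Set.EqOn u g (orthant d) := by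
  choose C hC using hb
  have hL : LipschitzOnWith (Real.toNNReal (∑ i, C i)) g (orthant d) := by
    refine (convex_orthant d).lipschitzOnWith_of_nnnorm_fderiv_le (𝕜 := ℝ)
      (fun x hx => differentiableAt_of_contDiffOn hg hx) fun x hx => ?_
    rw [← NNReal.coe_le_coe, coe_nnnorm]
    exact ((norm_fderiv_le_sum_pderiv g x).trans (Finset.sum_le_sum fun i _ => hC i x hx)).trans
      (Real.le_coe_toNNReal _)
  obtain ⟨u, hu, hug⟩ := hL.extend_finite_dimension
  exact ⟨u, hu.continuous.continuousOn, hug.symm⟩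

/-- The continuous extension of `D^p f` to the closed orthant is automatic: the bounds for `k = 0`
and the indices `p + e_i` control its gradient. Membership thus reduces to smoothness and seminorm
bounds. -/
theorem mem_schwartzSubmodule_of_bounds {f : (Fin d → ℝ) → 𝕜}
    (hf : ContDiffOn ℝ ∞ f (orthant d))
    (hb : ∀ k p : Fin d → ℕ, ∃ C, ∀ x ∈ orthant d, (∏ i, x i ^ k i) * ‖multiDeriv p f x‖ ≤ C) :
    (orthant d).indicator f ∈ schwartzSubmodule 𝕜 d := by
  have heq : Set.EqOn ((orthant d).indicator f) f (orthant d) :=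
    fun x hx => Set.indicator_of_mem hx _
  refine ⟨fun x hx => Set.indicator_of_notMem hx _, hf.congr heq, fun p => ?_, fun k p => ?_⟩
  · obtain ⟨u, hu, hu'⟩ := exists_continuousOn_extension (contDiffOn_multiDeriv p hf) fun i => by
      obtain ⟨C, hC⟩ := hb 0 (p + Pi.single i 1)
      refine ⟨C, fun x hx => ?_⟩
      rw [← multiDeriv_add_single p i hf hx]
      simpa using hC x hx
    exact ⟨u, hu, fun x hx => by rw [hu' hx, multiDeriv_congr p heq hx]⟩
  · obtain ⟨C, hC⟩ := hb k p
    refine ⟨C, ?_⟩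
    rintro _ ⟨x, rfl⟩
    simp only
    rw [multiDeriv_congr p heq x.2]
    exact hC x.1 x.2

end DerivativeCalculus

/-! ### Differentiation and coordinate multiplication as continuous operators. -/

section Operators

variable {𝕜 : Type*} [RCLike 𝕜] {d : ℕ}

instance : IsTopologicalAddGroup (SchwartzOrthant 𝕜 d) :=
  (schwartz_withSeminorms 𝕜 d).topologicalAddGroup

instance : ContinuousSMul 𝕜 (SchwartzOrthant 𝕜 d) :=
  (schwartz_withSeminorms 𝕜 d).continuousSMul

instance : IsTopologicalAddGroup (RapidSeq 𝕜 d) :=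
  (rapid_withSeminorms 𝕜 d).topologicalAddGroup

instance : ContinuousSMul 𝕜 (RapidSeq 𝕜 d) :=
  (rapid_withSeminorms 𝕜 d).continuousSMul

theorem continuous_schwartzSeminorm (k p : Fin d → ℕ) : Continuous (schwartzSeminorm 𝕜 d k p) :=
  (schwartz_withSeminorms 𝕜 d).continuous_seminorm (k, p)

theorem schwartzSeminorm_bound (k p : Fin d → ℕ) (f : SchwartzOrthant 𝕜 d) {x : Fin d → ℝ}
    (hx : x ∈ orthant d) :
    (∏ i, x i ^ k i) * ‖multiDeriv p f x‖ ≤ schwartzSeminorm 𝕜 d k p f :=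
  le_ciSup (f.2.2.2.2 k p) (⟨x, hx⟩ : orthant d)

theorem schwartzSeminorm_le {k p : Fin d → ℕ} {f : SchwartzOrthant 𝕜 d} {C : ℝ}
    (h : ∀ x ∈ orthant d, (∏ i, x i ^ k i) * ‖multiDeriv p f x‖ ≤ C) :
    schwartzSeminorm 𝕜 d k p f ≤ C :=
  ciSup_le fun x => h x.1 x.2

theorem schwartz_contDiffOn (f : SchwartzOrthant 𝕜 d) : ContDiffOn ℝ ∞ f (orthant d) := f.2.2.1

theorem schwartz_apply_of_notMem (f : SchwartzOrthant 𝕜 d) {x : Fin d → ℝ}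
    (hx : x ∉ orthant d) : f x = 0 := f.2.1 x hx

theorem schwartz_ext {f g : SchwartzOrthant 𝕜 d} (h : ∀ x ∈ orthant d, f x = g x) : f = g := by
  refine Subtype.ext (funext fun x => ?_)
  by_cases hx : x ∈ orthant d
  · exact h x hx
  · rw [schwartz_apply_of_notMem f hx, schwartz_apply_of_notMem g hx]

@[simp]
theorem schwartz_add_apply (f g : SchwartzOrthant 𝕜 d) (x : Fin d → ℝ) :
    (f + g) x = f x + g x := rfl

@[simp]
theorem schwartz_smul_apply (c : 𝕜) (f : SchwartzOrthant 𝕜 d) (x : Fin d → ℝ) :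
    (c • f) x = c * f x := rfl

theorem continuous_of_seminorm_bounds {E : Type*} [AddCommGroup E] [Module 𝕜 E]
    [TopologicalSpace E] [IsTopologicalAddGroup E] (T : E →ₗ[𝕜] SchwartzOrthant 𝕜 d)
    (h : ∀ k p, ∃ q : Seminorm 𝕜 E, Continuous q ∧ ∀ f, schwartzSeminorm 𝕜 d k p (T f) ≤ q f) :
    Continuous T := by
  refine WithSeminorms.continuous_of_continuous_comp (schwartz_withSeminorms 𝕜 d) T fun kp => ?_
  obtain ⟨q, hq, hle⟩ := h kp.1 kp.2
  exact Seminorm.continuous_of_le hq hle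

theorem multiDeriv_indicator (p : Fin d → ℕ) (f : (Fin d → ℝ) → 𝕜) :
    Set.EqOn (multiDeriv p ((orthant d).indicator f)) (multiDeriv p f) (orthant d) :=
  multiDeriv_congr p fun _ hx => Set.indicator_of_mem hx _

theorem multiDeriv_pderiv_bound (k p : Fin d → ℕ) (i : Fin d) (f : SchwartzOrthant 𝕜 d)
    {x : Fin d → ℝ} (hx : x ∈ orthant d) : (∏ i, x i ^ k i) * ‖multiDeriv p (pderiv i f) x‖
      ≤ schwartzSeminorm 𝕜 d k (p + Pi.single i 1) f := by
  rw [multiDeriv_pderiv p i (schwartz_contDiffOn f) hx,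
    ← multiDeriv_add_single p i (schwartz_contDiffOn f) hx]
  exact schwartzSeminorm_bound _ _ f hx

theorem prod_pow_add_single (k : Fin d → ℕ) (i : Fin d) (x : Fin d → ℝ) :
    ∏ j, x j ^ (k + Pi.single i 1 : Fin d → ℕ) j = (∏ j, x j ^ k j) * x i := by
  simp only [Pi.add_apply, pow_add, Finset.prod_mul_distrib]
  congr 1
  rw [Finset.prod_eq_single i]
  · simp
  · intro j _ hj; simp [Pi.single_eq_of_ne hj]
  · simp

theorem multiDeriv_coord_mul_bound (k p : Fin d → ℕ) (i : Fin d) (f : SchwartzOrthant 𝕜 d)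
    {x : Fin d → ℝ} (hx : x ∈ orthant d) :
    (∏ i, x i ^ k i) * ‖multiDeriv p (fun y => (y i : 𝕜) * f y) x‖
      ≤ schwartzSeminorm 𝕜 d (k + Pi.single i 1) p f
        + p i * schwartzSeminorm 𝕜 d k (p - Pi.single i 1) f := by
  rw [multiDeriv_coord_mul i (schwartz_contDiffOn f) p hx]
  have h1 := schwartzSeminorm_bound (k + Pi.single i 1) p f hx
  have h2 := schwartzSeminorm_bound k (p - Pi.single i 1) f hx
  have h4 := prod_pow_nonneg k hx
  rw [prod_pow_add_single] at h1
  calc _ ≤ (∏ j, x j ^ k j) * (x i * ‖multiDeriv p f x‖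
        + p i * ‖multiDeriv (p - Pi.single i 1) f x‖) := by
        refine mul_le_mul_of_nonneg_left ((norm_add_le _ _).trans_eq ?_) h4
        rw [norm_mul, norm_mul, RCLike.norm_ofReal, abs_of_pos (hx i), RCLike.norm_natCast]
    _ = (∏ j, x j ^ k j) * x i * ‖multiDeriv p f x‖
        + p i * ((∏ j, x j ^ k j) * ‖multiDeriv (p - Pi.single i 1) f x‖) := by ring
    _ ≤ _ := by gcongr

/-- The partial derivative `∂/∂x_i` as a linear operator of `𝒮(ℝ^d_+)`. -/
def derivSLin (i : Fin d) : SchwartzOrthant 𝕜 d →ₗ[𝕜] SchwartzOrthant 𝕜 d where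
  toFun f := ⟨(orthant d).indicator (pderiv i f), mem_schwartzSubmodule_of_bounds
    (contDiffOn_pderiv i (schwartz_contDiffOn f))
    fun k p => ⟨_, fun _ hx => multiDeriv_pderiv_bound k p i f hx⟩⟩
  map_add' f g := by
    refine schwartz_ext fun x hx => ?_
    change (orthant d).indicator (pderiv i (f.1 + g.1)) x
      = (orthant d).indicator (pderiv i f) x + (orthant d).indicator (pderiv i g) x
    simp only [Set.indicator_of_mem hx]
    simp [pderiv, fderiv_add (differentiableAt_of_contDiffOn (schwartz_contDiffOn f) hx)
      (differentiableAt_of_contDiffOn (schwartz_contDiffOn g) hx)]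
  map_smul' c f := by
    refine schwartz_ext fun x hx => ?_
    change (orthant d).indicator (pderiv i (c • f.1)) x
      = c * (orthant d).indicator (pderiv i f) x
    simp only [Set.indicator_of_mem hx]
    simp [pderiv, fderiv_const_smul (differentiableAt_of_contDiffOn (schwartz_contDiffOn f) hx)]

/-- The partial derivative `∂/∂x_i` as a continuous operator of `𝒮(ℝ^d_+)`. -/
def derivS (i : Fin d) : SchwartzOrthant 𝕜 d →L[𝕜] SchwartzOrthant 𝕜 d where
  toLinearMap := derivSLin i
  cont := by
    refine continuous_of_seminorm_bounds (derivSLin i) fun k p =>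
      ⟨schwartzSeminorm 𝕜 d k (p + Pi.single i 1), continuous_schwartzSeminorm _ _, fun f =>
        schwartzSeminorm_le fun x hx => ?_⟩
    refine le_of_eq_of_le ?_ (multiDeriv_pderiv_bound k p i f hx)
    congr 2
    exact multiDeriv_indicator p _ hx

/-- Multiplication by the coordinate `x_i` as a linear operator of `𝒮(ℝ^d_+)`. -/
def mulSLin (i : Fin d) : SchwartzOrthant 𝕜 d →ₗ[𝕜] SchwartzOrthant 𝕜 d where
  toFun f := ⟨(orthant d).indicator fun y => (y i : 𝕜) * f y, mem_schwartzSubmodule_of_bounds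
    (contDiffOn_coord_mul i (schwartz_contDiffOn f))
    fun k p => ⟨_, fun _ hx => multiDeriv_coord_mul_bound k p i f hx⟩⟩
  map_add' f g := by
    refine schwartz_ext fun x hx => ?_
    change (orthant d).indicator (fun y => (y i : 𝕜) * (f y + g y)) x
      = (orthant d).indicator (fun y => (y i : 𝕜) * f y) x
        + (orthant d).indicator (fun y => (y i : 𝕜) * g y) x
    simp only [Set.indicator_of_mem hx, mul_add]
  map_smul' c f := by
    refine schwartz_ext fun x hx => ?_
    change (orthant d).indicator (fun y => (y i : 𝕜) * (c * f y)) x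
      = c * (orthant d).indicator (fun y => (y i : 𝕜) * f y) x
    simp only [Set.indicator_of_mem hx]
    ring

/-- Multiplication by the coordinate `x_i` as a continuous operator of `𝒮(ℝ^d_+)`. -/
def mulS (i : Fin d) : SchwartzOrthant 𝕜 d →L[𝕜] SchwartzOrthant 𝕜 d where
  toLinearMap := mulSLin i
  cont := by
    refine continuous_of_seminorm_bounds (mulSLin i) fun k p =>
      ⟨schwartzSeminorm 𝕜 d (k + Pi.single i 1) p
        + (p i : NNReal) • schwartzSeminorm 𝕜 d k (p - Pi.single i 1),
        (continuous_schwartzSeminorm _ _).add ((continuous_schwartzSeminorm _ _).const_smul _),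
        fun f => schwartzSeminorm_le fun x hx => ?_⟩
    refine le_of_eq_of_le ?_ (multiDeriv_coord_mul_bound k p i f hx)
    congr 2
    exact multiDeriv_indicator p _ hx

theorem derivS_apply (i : Fin d) (f : SchwartzOrthant 𝕜 d) {x : Fin d → ℝ}
    (hx : x ∈ orthant d) : derivS i f x = pderiv i f x :=
  Set.indicator_of_mem hx _

theorem mulS_apply (i : Fin d) (f : SchwartzOrthant 𝕜 d) (x : Fin d → ℝ) :
    mulS i f x = (x i : 𝕜) * f x := by
  by_cases hx : x ∈ orthant d
  · exact Set.indicator_of_mem hx fun y : Fin d → ℝ => (y i : 𝕜) * f y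
  · rw [schwartz_apply_of_notMem _ hx, schwartz_apply_of_notMem _ hx, mul_zero]

end Operators

/-! ### Absolutely convergent series in the function space. -/

section Completeness

variable {𝕜 : Type*} [RCLike 𝕜] {d : ℕ}

/-- The evaluation `f ↦ D^p f(x)` at a point of the orthant as a linear functional. -/
def evalDeriv (p : Fin d → ℕ) {x : Fin d → ℝ} (hx : x ∈ orthant d) :
    SchwartzOrthant 𝕜 d →ₗ[𝕜] 𝕜 where
  toFun f := multiDeriv p f x
  map_add' f g := multiDeriv_add p (schwartz_contDiffOn f) (schwartz_contDiffOn g) hx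
  map_smul' c f := multiDeriv_smul p c (schwartz_contDiffOn f) hx

theorem norm_multiDeriv_le (p : Fin d → ℕ) (f : SchwartzOrthant 𝕜 d) {x : Fin d → ℝ}
    (hx : x ∈ orthant d) : ‖multiDeriv p f x‖ ≤ schwartzSeminorm 𝕜 d 0 p f := by
  simpa using schwartzSeminorm_bound 0 p f hx

theorem summable_multiDeriv {α : Type*} {g : α → SchwartzOrthant 𝕜 d} {p : Fin d → ℕ}
    (h : Summable fun a => schwartzSeminorm 𝕜 d 0 p (g a)) {x : Fin d → ℝ}
    (hx : x ∈ orthant d) : Summable fun a => multiDeriv p (g a) x :=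
  Summable.of_norm_bounded h fun a => norm_multiDeriv_le p (g a) hx

/-- Termwise differentiation: the series of gradients is dominated on the whole orthant by the
summable seminorms with indices `p + e_i`. -/
theorem hasFDerivAt_tsum_multiDeriv {α : Type*} {g : α → SchwartzOrthant 𝕜 d}
    (h : ∀ k p, Summable fun a => schwartzSeminorm 𝕜 d k p (g a)) (p : Fin d → ℕ)
    {x : Fin d → ℝ} (hx : x ∈ orthant d) :
    HasFDerivAt (fun y => ∑' a, multiDeriv p (g a) y)
      (∑ i, (ContinuousLinearMap.proj (R := ℝ) (φ := fun _ : Fin d => ℝ) i).smulRight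
        (∑' a, multiDeriv (p + Pi.single i 1) (g a) x)) x := by
  have hd : ∀ a, ∀ y ∈ orthant d, DifferentiableAt ℝ (multiDeriv p (g a)) y := fun a y hy =>
    differentiableAt_of_contDiffOn (contDiffOn_multiDeriv p (schwartz_contDiffOn (g a))) hy
  have hu : Summable fun a => ∑ i, schwartzSeminorm 𝕜 d 0 (p + Pi.single i 1) (g a) :=
    summable_sum fun i _ => h 0 (p + Pi.single i 1)
  have hb : ∀ a, ∀ y ∈ orthant d, ‖fderiv ℝ (multiDeriv p (g a)) y‖
      ≤ ∑ i, schwartzSeminorm 𝕜 d 0 (p + Pi.single i 1) (g a) := fun a y hy =>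
    (norm_fderiv_le_sum_pderiv _ _).trans (Finset.sum_le_sum fun i _ => by
      rw [← multiDeriv_add_single p i (schwartz_contDiffOn (g a)) hy]
      exact norm_multiDeriv_le _ _ hy)
  have key := hasFDerivAt_tsum_of_isPreconnected hu (isOpen_orthant d)
    (convex_orthant d).isPreconnected (fun a y hy => (hd a y hy).hasFDerivAt) hb hx
    (summable_multiDeriv (h 0 p) hx) hx
  refine key.congr_fderiv ?_
  have hs : Summable fun a => fderiv ℝ (multiDeriv p (g a)) x :=
    Summable.of_norm_bounded hu fun a => hb a x hx
  have h2 := fun i => (ContinuousLinearMap.apply ℝ 𝕜 (Pi.single i (1 : ℝ))).map_tsum hs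
  ext v
  simp only [ContinuousLinearMap.apply_apply] at h2
  conv_lhs => rw [← Finset.univ_sum_single v, map_sum]
  simp only [_root_.sum_apply, ContinuousLinearMap.smulRight_apply, ContinuousLinearMap.proj_apply]
  refine Finset.sum_congr rfl fun i _ => ?_
  have h4 : Pi.single i (v i) = v i • (Pi.single i (1 : ℝ) : Fin d → ℝ) := by
    rw [← Pi.single_smul, smul_eq_mul, mul_one]
  rw [h4, map_smul, h2 i]
  congr 1
  refine tsum_congr fun a => ?_
  exact (multiDeriv_add_single p i (schwartz_contDiffOn (g a)) hx).symm

/-- The derivative of the series for `p` is assembled from the series for `p + e_i`, so the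
induction on the order of smoothness keeps `p` arbitrary. -/
theorem contDiffOn_tsum_multiDeriv {α : Type*} {g : α → SchwartzOrthant 𝕜 d}
    (h : ∀ k p, Summable fun a => schwartzSeminorm 𝕜 d k p (g a)) (p : Fin d → ℕ) :
    ContDiffOn ℝ ∞ (fun y => ∑' a, multiDeriv p (g a) y) (orthant d) := by
  rw [contDiffOn_infty]
  intro n
  induction n generalizing p with
  | zero =>
    exact contDiffOn_zero.2 fun x hx =>
      (hasFDerivAt_tsum_multiDeriv h p hx).continuousAt.continuousWithinAt
  | succ n ih =>
    have := (contDiffOn_succ_iff_fderiv_of_isOpen (𝕜 := ℝ) (n := n)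
      (f := fun y => ∑' a, multiDeriv p (g a) y) (isOpen_orthant d)).2
    refine this ⟨fun x hx =>
      (hasFDerivAt_tsum_multiDeriv h p hx).differentiableAt.differentiableWithinAt,
      fun hn => absurd hn (by simp), ?_⟩
    refine ContDiffOn.congr (f := fun x => ∑ i, (ContinuousLinearMap.proj (R := ℝ)
      (φ := fun _ : Fin d => ℝ) i).smulRight (∑' a, multiDeriv (p + Pi.single i 1) (g a) x)) ?_
      fun x hx => (hasFDerivAt_tsum_multiDeriv h p hx).fderiv
    refine ContDiffOn.sum fun i _ => ?_
    exact (ContinuousLinearMap.smulRightL ℝ (Fin d → ℝ) 𝕜 (ContinuousLinearMap.proj i)).contDiff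
      |>.comp_contDiffOn (ih _)

theorem multiDeriv_tsum {α : Type*} {g : α → SchwartzOrthant 𝕜 d}
    (h : ∀ k p, Summable fun a => schwartzSeminorm 𝕜 d k p (g a)) (p : Fin d → ℕ) :
    Set.EqOn (multiDeriv p fun y => ∑' a, g a y) (fun x => ∑' a, multiDeriv p (g a) x)
      (orthant d) := by
  have h0 : (fun y => ∑' a, g a y) = fun y => ∑' a, multiDeriv 0 (g a) y := by
    simp [multiDeriv_zero_index]
  induction p using multiIndex_induction with
  | h0 => rw [multiDeriv_zero_index, h0]; exact fun _ _ => rfl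
  | hs p i ih =>
    intro x hx
    rw [multiDeriv_add_single p i (h0 ▸ contDiffOn_tsum_multiDeriv h 0) hx, pderiv_congr i ih hx,
      pderiv, (hasFDerivAt_tsum_multiDeriv h p hx).fderiv]
    simp only [_root_.sum_apply, ContinuousLinearMap.smulRight_apply,
      ContinuousLinearMap.proj_apply]
    rw [Finset.sum_eq_single i]
    · simp
    · intro j _ hj; simp [Pi.single_eq_of_ne hj]
    · simp

theorem weighted_norm_tsum_le {α : Type*} {g : α → SchwartzOrthant 𝕜 d} {k p : Fin d → ℕ}
    (h : Summable fun a => schwartzSeminorm 𝕜 d k p (g a)) {x : Fin d → ℝ} (hx : x ∈ orthant d) :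
    (∏ i, x i ^ k i) * ‖∑' a, multiDeriv p (g a) x‖ ≤ ∑' a, schwartzSeminorm 𝕜 d k p (g a) := by
  have h4 := prod_pow_nonneg k hx
  have h5 : ∀ a, ‖((∏ i, x i ^ k i : ℝ) : 𝕜) * multiDeriv p (g a) x‖
      ≤ schwartzSeminorm 𝕜 d k p (g a) := by
    intro a
    rw [norm_mul, RCLike.norm_ofReal, abs_of_nonneg h4]
    exact schwartzSeminorm_bound k p (g a) hx
  have h6 := tsum_of_norm_bounded h.hasSum h5
  rwa [tsum_mul_left, norm_mul, RCLike.norm_ofReal, abs_of_nonneg h4] at h6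

/-- Completeness of `𝒮(ℝ^d_+)`: absolutely convergent series converge. -/
theorem exists_hasSum_of_summable_seminorms {α : Type*} {g : α → SchwartzOrthant 𝕜 d}
    (h : ∀ k p, Summable fun a => schwartzSeminorm 𝕜 d k p (g a)) :
    ∃ f : SchwartzOrthant 𝕜 d, HasSum g f := by
  have h0 : ContDiffOn ℝ ∞ (fun y => ∑' a, g a y) (orthant d) := by
    have := contDiffOn_tsum_multiDeriv h 0
    simpa only [multiDeriv_zero_index] using this
  let f : SchwartzOrthant 𝕜 d := ⟨(orthant d).indicator fun y => ∑' a, g a y,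
    mem_schwartzSubmodule_of_bounds h0 fun k p => ⟨_, fun x hx => by
      rw [multiDeriv_tsum h p hx]; exact weighted_norm_tsum_le (h k p) hx⟩⟩
  refine ⟨f, ((schwartz_withSeminorms 𝕜 d).tendsto_nhds _ _).2 fun kp ε hε => ?_⟩
  -- The error of a partial sum is the tail of the series, and its seminorm is at most the tail of
  -- the summable seminorms.
  have hlim := tendsto_tsum_compl_atTop_zero fun a => schwartzSeminorm 𝕜 d kp.1 kp.2 (g a)
  filter_upwards [hlim.eventually (gt_mem_nhds hε)] with s hs
  refine lt_of_le_of_lt ?_ hs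
  refine schwartzSeminorm_le fun x hx => ?_
  have h1 : multiDeriv kp.2 f x = ∑' a, multiDeriv kp.2 (g a) x :=
    (multiDeriv_indicator kp.2 _ hx).trans (multiDeriv_tsum h kp.2 hx)
  have h2 : ‖multiDeriv kp.2 (∑ a ∈ s, g a - f : SchwartzOrthant 𝕜 d) x‖
      = ‖∑' a : {a // a ∉ s}, multiDeriv kp.2 (g a) x‖ := by
    have h3 := map_sub (evalDeriv (𝕜 := 𝕜) kp.2 hx) (∑ a ∈ s, g a) f
    rw [map_sum] at h3
    change multiDeriv kp.2 (∑ a ∈ s, g a - f : SchwartzOrthant 𝕜 d) x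
      = ∑ a ∈ s, multiDeriv kp.2 (g a) x - multiDeriv kp.2 f x at h3
    rw [h3, h1, ← (summable_multiDeriv (h 0 kp.2) hx).sum_add_tsum_subtype_compl s]
    simp
  rw [h2]
  exact weighted_norm_tsum_le (g := fun a : {a // a ∉ s} => g a)
    ((h kp.1 kp.2).comp_injective Subtype.val_injective) hx

end Completeness

/-! ### Recurrences and the eigenvalue equation for Laguerre functions. -/

section Recurrences

open Polynomial

variable (𝕜 : Type*) [RCLike 𝕜] {d : ℕ}

/-- Tensor products of polynomials times `e^{-x/2}`, as elements of `𝒮(ℝ^d_+)`. -/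
def tensorS (P : Fin d → ℝ[X]) : SchwartzOrthant 𝕜 d :=
  ⟨(orthant d).indicator (tensorFun 𝕜 P), tensorFun_mem 𝕜 P⟩

theorem tensorS_apply (P : Fin d → ℝ[X]) {x : Fin d → ℝ} (hx : x ∈ orthant d) :
    tensorS 𝕜 P x = tensorFun 𝕜 P x :=
  Set.indicator_of_mem hx _

theorem tensorFun_update (P : Fin d → ℝ[X]) (i : Fin d) (R : ℝ[X]) (x : Fin d → ℝ) :
    tensorFun 𝕜 (Function.update P i R) x = ((R.eval (x i) : ℝ) : 𝕜) *
      ((Real.exp (-x i / 2) * ∏ j ∈ Finset.univ.erase i,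
        ((P j).eval (x j) * Real.exp (-x j / 2)) : ℝ) : 𝕜) := by
  rw [tensorFun, ← RCLike.ofReal_mul, ← Finset.mul_prod_erase _ _ (Finset.mem_univ i),
    Function.update_self, mul_assoc]
  congr 3
  refine Finset.prod_congr rfl fun j hj => ?_
  rw [Function.update_of_ne (Finset.ne_of_mem_erase hj)]

/-- The element of `𝒮(ℝ^d_+)` obtained by replacing the `i`-th factor, as an additive function of
this factor. -/
def tensorUpdate (P : Fin d → ℝ[X]) (i : Fin d) : ℝ[X] →+ SchwartzOrthant 𝕜 d where
  toFun R := tensorS 𝕜 (Function.update P i R)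
  map_zero' := schwartz_ext fun x hx => by
    rw [tensorS_apply 𝕜 _ hx, tensorFun_update]
    simp only [eval_zero, RCLike.ofReal_zero, zero_mul]
    rfl
  map_add' R S := schwartz_ext fun x hx => by
    rw [schwartz_add_apply]
    simp only [tensorS_apply 𝕜 _ hx, tensorFun_update, eval_add, RCLike.ofReal_add, add_mul]

theorem tensorUpdate_C_mul (P : Fin d → ℝ[X]) (i : Fin d) (c : ℝ) (R : ℝ[X]) :
    tensorUpdate 𝕜 P i (C c * R) = (c : 𝕜) • tensorUpdate 𝕜 P i R :=
  schwartz_ext fun x hx => by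
    rw [schwartz_smul_apply]
    change tensorS 𝕜 _ x = _ * tensorS 𝕜 _ x
    simp only [tensorS_apply 𝕜 _ hx, tensorFun_update, eval_mul, eval_C, RCLike.ofReal_mul,
      mul_assoc]

theorem derivS_tensorUpdate (P : Fin d → ℝ[X]) (i : Fin d) (R : ℝ[X]) :
    derivS i (tensorUpdate 𝕜 P i R) = tensorUpdate 𝕜 P i (derivative R - C (1 / 2) * R) :=
  schwartz_ext fun x hx => by
    rw [derivS_apply i _ hx]
    change pderiv i ((orthant d).indicator (tensorFun 𝕜 _)) x = tensorS 𝕜 _ x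
    rw [pderiv_congr i (fun y hy => Set.indicator_of_mem hy _) hx, tensorS_apply 𝕜 _ hx,
      pderiv_tensorFun, Function.update_self, Function.update_idem]

theorem mulS_tensorUpdate (P : Fin d → ℝ[X]) (i : Fin d) (R : ℝ[X]) :
    mulS i (tensorUpdate 𝕜 P i R) = tensorUpdate 𝕜 P i (X * R) :=
  schwartz_ext fun x hx => by
    rw [mulS_apply]
    change _ * tensorS 𝕜 _ x = tensorS 𝕜 _ x
    simp only [tensorS_apply 𝕜 _ hx, tensorFun_update, eval_mul, eval_X, RCLike.ofReal_mul,
      mul_assoc]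

theorem laguerre_apply (n : Fin d → ℕ) {x : Fin d → ℝ} (hx : x ∈ orthant d) :
    laguerre 𝕜 n x = ((∏ i, laguerreFun (n i) (x i) : ℝ) : 𝕜) :=
  Set.indicator_of_mem hx fun x : Fin d → ℝ => ((∏ i, laguerreFun (n i) (x i) : ℝ) : 𝕜)

theorem laguerre_update (n : Fin d → ℕ) (i : Fin d) (m : ℕ) :
    laguerre 𝕜 (Function.update n i m)
      = tensorUpdate 𝕜 (fun j => laguerreP (n j)) i (laguerreP m) :=
  schwartz_ext fun x hx => by
    change _ = tensorS 𝕜 _ x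
    rw [laguerre_apply 𝕜 _ hx, tensorS_apply 𝕜 _ hx, tensorFun]
    congr 1
    refine Finset.prod_congr rfl fun j _ => ?_
    rw [laguerreFun_eq_eval]
    congr 2
    by_cases hj : j = i
    · subst hj; simp
    · simp [hj]

theorem laguerre_eq_tensorUpdate (n : Fin d → ℕ) (i : Fin d) :
    laguerre 𝕜 n = tensorUpdate 𝕜 (fun j => laguerreP (n j)) i (laguerreP (n i)) := by
  rw [← laguerre_update, Function.update_eq_self]

theorem mulS_laguerre (n : Fin d → ℕ) (i : Fin d) :
    mulS i (laguerre 𝕜 n) =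
      ((-((n i : ℝ) + 1) : ℝ) : 𝕜) • laguerre 𝕜 (Function.update n i (n i + 1))
      + ((2 * (n i : ℝ) + 1 : ℝ) : 𝕜) • laguerre 𝕜 n
      - ((n i : ℝ) : 𝕜) • laguerre 𝕜 (Function.update n i (n i - 1)) := by
  rw [laguerre_update, laguerre_update, laguerre_eq_tensorUpdate 𝕜 n i, mulS_tensorUpdate,
    X_mul_laguerreP, map_sub, map_add, ← C_neg, tensorUpdate_C_mul, tensorUpdate_C_mul,
    tensorUpdate_C_mul]

theorem derivS_laguerre (n : Fin d → ℕ) (i : Fin d) :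
    derivS i (laguerre 𝕜 n) = -∑ j ∈ Finset.range (n i), laguerre 𝕜 (Function.update n i j)
      - ((1 / 2 : ℝ) : 𝕜) • laguerre 𝕜 n := by
  simp only [laguerre_update]
  rw [laguerre_eq_tensorUpdate 𝕜 n i, derivS_tensorUpdate, derivative_laguerreP, map_sub, map_neg,
    map_sum, tensorUpdate_C_mul]

/-- The operator `-∂_i x_i ∂_i + x_i / 4`, which has the Laguerre functions as eigenvectors. -/
def laguerreOp (i : Fin d) : SchwartzOrthant 𝕜 d →L[𝕜] SchwartzOrthant 𝕜 d :=
  ((1 / 4 : ℝ) : 𝕜) • mulS i - (derivS i).comp ((mulS i).comp (derivS i))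

/-- On `P e^{-t/2}` a derivative acts on `P` as `D - 1/2`, so the operator becomes `P ↦ -(X P'' + (1
- X) P') + P / 2`, and the Laguerre equation applies. -/
theorem laguerreOp_laguerre (n : Fin d → ℕ) (i : Fin d) :
    laguerreOp 𝕜 i (laguerre 𝕜 n) = (((n i : ℝ) + 1 / 2 : ℝ) : 𝕜) • laguerre 𝕜 n := by
  rw [laguerreOp, laguerre_eq_tensorUpdate 𝕜 n i]
  simp only [_root_.sub_apply, _root_.smul_apply,
    ContinuousLinearMap.comp_apply, mulS_tensorUpdate, derivS_tensorUpdate]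
  rw [← tensorUpdate_C_mul, ← tensorUpdate_C_mul, ← map_sub]
  congr 1
  have h := laguerreP_ode (n i)
  have h4 : (C (1 / 4) : ℝ[X]) = C (1 / 2) * C (1 / 2) := by rw [← C_mul]; norm_num
  have h2 : (C (1 / 2) : ℝ[X]) + C (1 / 2) = 1 := by rw [← C_add]; norm_num
  simp only [derivative_mul, derivative_sub, derivative_X, derivative_C, C_add, h4]
  linear_combination (-1 : ℝ[X]) * h + X * derivative (laguerreP (n i)) * h2

end Recurrences

/-! ### Polynomial growth of seminorms along the Laguerre functions. -/

section Growth

variable {d : ℕ}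

/-- The weight `1 + |n|`. -/
def indexWeight (n : Fin d → ℕ) : ℝ := 1 + ((∑ i, n i : ℕ) : ℝ)

theorem one_le_indexWeight (n : Fin d → ℕ) : 1 ≤ indexWeight n := by
  unfold indexWeight
  have : (0 : ℝ) ≤ ((∑ i, n i : ℕ) : ℝ) := Nat.cast_nonneg _
  linarith

theorem indexWeight_pos (n : Fin d → ℕ) : 0 < indexWeight n :=
  one_pos.trans_le (one_le_indexWeight n)

theorem coord_add_one_le_indexWeight (n : Fin d → ℕ) (i : Fin d) :
    (n i : ℝ) + 1 ≤ indexWeight n := by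
  unfold indexWeight
  have : n i ≤ ∑ i, n i := Finset.single_le_sum (f := n) (fun _ _ => Nat.zero_le _)
    (Finset.mem_univ i)
  have : (n i : ℝ) ≤ ((∑ i, n i : ℕ) : ℝ) := by exact_mod_cast this
  linarith

theorem indexWeight_update_le (n : Fin d → ℕ) (i : Fin d) {m : ℕ} (hm : m ≤ n i + 1) :
    indexWeight (Function.update n i m) ≤ 2 * indexWeight n := by
  have h : ∑ j, Function.update n i m j ≤ ∑ j, n j + 1 := by
    rw [← Finset.add_sum_erase _ _ (Finset.mem_univ i),
      ← Finset.add_sum_erase _ n (Finset.mem_univ i), Function.update_self]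
    have : ∑ j ∈ Finset.univ.erase i, Function.update n i m j = ∑ j ∈ Finset.univ.erase i, n j :=
      Finset.sum_congr rfl fun j hj => Function.update_of_ne (Finset.ne_of_mem_erase hj) _ _
    omega
  have h' : ((∑ j, Function.update n i m j : ℕ) : ℝ) ≤ ((∑ j, n j : ℕ) : ℝ) + 1 := by
    exact_mod_cast h
  have h0 : (0 : ℝ) ≤ ((∑ j, n j : ℕ) : ℝ) := Nat.cast_nonneg _
  unfold indexWeight
  linarith

/-- Polynomially bounded families over `ℕ^d`. -/
def PolyBounded (u : (Fin d → ℕ) → ℝ) : Prop :=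
  ∃ (C : ℝ) (M : ℕ), 0 ≤ C ∧ ∀ n, u n ≤ C * indexWeight n ^ M

theorem PolyBounded.mono {u v : (Fin d → ℕ) → ℝ} (hv : PolyBounded v) (h : ∀ n, u n ≤ v n) :
    PolyBounded u := by
  obtain ⟨C, M, hC, hb⟩ := hv
  exact ⟨C, M, hC, fun n => (h n).trans (hb n)⟩

theorem PolyBounded.add {u v : (Fin d → ℕ) → ℝ} (hu : PolyBounded u) (hv : PolyBounded v) :
    PolyBounded fun n => u n + v n := by
  obtain ⟨C, M, hC, hb⟩ := hu
  obtain ⟨C', M', hC', hb'⟩ := hv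
  refine ⟨C + C', M + M', by positivity, fun n => ?_⟩
  have h1 := one_le_indexWeight n
  have h2 : indexWeight n ^ M ≤ indexWeight n ^ (M + M') := pow_le_pow_right₀ h1 (by omega)
  have h3 : indexWeight n ^ M' ≤ indexWeight n ^ (M + M') := pow_le_pow_right₀ h1 (by omega)
  rw [add_mul]
  exact add_le_add ((hb n).trans (by gcongr)) ((hb' n).trans (by gcongr))

theorem PolyBounded.const_mul {u : (Fin d → ℕ) → ℝ} (hu : PolyBounded u) {c : ℝ} (hc : 0 ≤ c) :
    PolyBounded fun n => c * u n := by
  obtain ⟨C, M, hC, hb⟩ := hu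
  refine ⟨c * C, M, by positivity, fun n => ?_⟩
  rw [mul_assoc]
  exact mul_le_mul_of_nonneg_left (hb n) hc

variable (𝕜 : Type*) [RCLike 𝕜]

/-- Seminorms with at most polynomial growth along the Laguerre functions. -/
def PolyGrowth (q : Seminorm 𝕜 (SchwartzOrthant 𝕜 d)) : Prop :=
  PolyBounded fun n => q (laguerre 𝕜 n)

variable {𝕜}

/-- Both recurrences involve only indices whose `i`-th entry is at most `n_i + 1`; such a change at
most doubles the weight. -/
theorem PolyGrowth.exists_update_bound {q : Seminorm 𝕜 (SchwartzOrthant 𝕜 d)}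
    (hq : PolyGrowth 𝕜 q) : ∃ (C : ℝ) (M : ℕ), 0 ≤ C ∧ ∀ n i m, m ≤ n i + 1 →
      q (laguerre 𝕜 (Function.update n i m)) ≤ C * indexWeight n ^ M := by
  obtain ⟨C, M, hC, hb⟩ := hq
  refine ⟨C * 2 ^ M, M, by positivity, fun n i m hm => (hb _).trans ?_⟩
  rw [mul_assoc, ← mul_pow]
  have := (indexWeight_pos (Function.update n i m)).le
  gcongr
  exact indexWeight_update_le n i hm

theorem PolyGrowth.comp_mulS {q : Seminorm 𝕜 (SchwartzOrthant 𝕜 d)} (hq : PolyGrowth 𝕜 q)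
    (i : Fin d) : PolyBounded fun n => q (mulS i (laguerre 𝕜 n)) := by
  obtain ⟨C, M, hC, hb⟩ := hq.exists_update_bound
  -- The recurrence coefficients have absolute values adding up to `4 n_i + 2`, which is at most `4
  -- (1 + |n|)`.
  refine ⟨4 * C, M + 1, by positivity, fun n => ?_⟩
  have h1 := hb n i (n i + 1) le_rfl
  have h2 := hb n i (n i) (by omega)
  have h3 := hb n i (n i - 1) (by omega)
  rw [Function.update_eq_self] at h2
  have hn : (0 : ℝ) ≤ n i := Nat.cast_nonneg _
  have hw := coord_add_one_le_indexWeight n i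
  have hw0 := indexWeight_pos n
  beta_reduce
  rw [mulS_laguerre]
  calc _ ≤ q (((-((n i : ℝ) + 1) : ℝ) : 𝕜) • laguerre 𝕜 (Function.update n i (n i + 1)))
      + q (((2 * (n i : ℝ) + 1 : ℝ) : 𝕜) • laguerre 𝕜 n)
      + q (((n i : ℝ) : 𝕜) • laguerre 𝕜 (Function.update n i (n i - 1))) :=
        (map_sub_le_add q _ _).trans (add_le_add_left (map_add_le_add q _ _) _)
    _ = ((n i : ℝ) + 1) * q (laguerre 𝕜 (Function.update n i (n i + 1)))
      + (2 * (n i : ℝ) + 1) * q (laguerre 𝕜 n)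
      + (n i : ℝ) * q (laguerre 𝕜 (Function.update n i (n i - 1))) := by
        simp only [map_smul_eq_mul, RCLike.norm_ofReal, abs_neg]
        rw [abs_of_nonneg (by positivity), abs_of_nonneg (by positivity : (0 : ℝ) ≤ 2 * n i + 1),
          abs_of_nonneg hn]
    _ ≤ ((n i : ℝ) + 1) * (C * indexWeight n ^ M) + (2 * (n i : ℝ) + 1) * (C * indexWeight n ^ M)
      + (n i : ℝ) * (C * indexWeight n ^ M) := by gcongr
    _ = (4 * (n i : ℝ) + 2) * (C * indexWeight n ^ M) := by ring
    _ ≤ (4 * indexWeight n) * (C * indexWeight n ^ M) := by gcongr; linarith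
    _ = _ := by ring

theorem PolyGrowth.comp_derivS {q : Seminorm 𝕜 (SchwartzOrthant 𝕜 d)} (hq : PolyGrowth 𝕜 q)
    (i : Fin d) : PolyBounded fun n => q (derivS i (laguerre 𝕜 n)) := by
  obtain ⟨C, M, hC, hb⟩ := hq.exists_update_bound
  -- The derivative is a sum of `n_i` Laguerre functions and half of another one, which costs the
  -- factor `n_i + 1/2`.
  refine ⟨C, M + 1, by positivity, fun n => ?_⟩
  have h2 := hb n i (n i) (by omega)
  rw [Function.update_eq_self] at h2
  have hw := coord_add_one_le_indexWeight n i
  have hw0 := indexWeight_pos n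
  beta_reduce
  rw [derivS_laguerre]
  calc _ ≤ q (∑ j ∈ Finset.range (n i), laguerre 𝕜 (Function.update n i j))
      + q (((1 / 2 : ℝ) : 𝕜) • laguerre 𝕜 n) := by
        refine (map_sub_le_add q _ _).trans_eq ?_
        rw [map_neg_eq_map]
    _ ≤ ∑ j ∈ Finset.range (n i), q (laguerre 𝕜 (Function.update n i j))
      + 1 / 2 * q (laguerre 𝕜 n) := by
        refine add_le_add (Finset.le_sum_of_subadditive q (map_zero q).le (map_add_le_add q) _ _) (le_of_eq ?_)
        rw [map_smul_eq_mul, RCLike.norm_ofReal, abs_of_pos (by norm_num)]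
    _ ≤ ∑ j ∈ Finset.range (n i), C * indexWeight n ^ M + 1 / 2 * (C * indexWeight n ^ M) := by
        gcongr with j hj
        exact hb n i j (by have := Finset.mem_range.1 hj; omega)
    _ = ((n i : ℝ) + 1 / 2) * (C * indexWeight n ^ M) := by
        rw [Finset.sum_const, Finset.card_range, nsmul_eq_mul]; ring
    _ ≤ indexWeight n * (C * indexWeight n ^ M) := by gcongr; linarith
    _ = _ := by ring

theorem norm_laguerre_le (n : Fin d → ℕ) {x : Fin d → ℝ} (hx : x ∈ orthant d) :
    ‖laguerre 𝕜 n x‖ ≤ 2 ^ d * indexWeight n ^ d := by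
  rw [laguerre_apply 𝕜 n hx, RCLike.norm_ofReal, Finset.abs_prod, ← mul_pow]
  calc ∏ i, |laguerreFun (n i) (x i)| ≤ ∏ _i : Fin d, (2 * indexWeight n) := by
        refine Finset.prod_le_prod (fun _ _ => abs_nonneg _) fun i _ => ?_
        refine (abs_laguerreFun_le (n i) (hx i)).trans ?_
        have := coord_add_one_le_indexWeight n i
        have := one_le_indexWeight n
        linarith
    _ = _ := by simp

/-- Induction from the sup norm: first on `p` with `k = 0`, applying `∂_i`, then on `k` for all `p`
at once, since commuting `x_i` with `D^p` lowers `p`. -/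
theorem polyGrowth_schwartzSeminorm (k p : Fin d → ℕ) :
    PolyGrowth 𝕜 (schwartzSeminorm 𝕜 d k p) := by
  induction k using multiIndex_induction generalizing p with
  | h0 =>
    induction p using multiIndex_induction with
    | h0 =>
      refine ⟨2 ^ d, d, by positivity, fun n => schwartzSeminorm_le fun x hx => ?_⟩
      simpa [multiDeriv_zero_index] using norm_laguerre_le (𝕜 := 𝕜) n hx
    | hs p i ih =>
      refine (ih.comp_derivS i).mono fun n => schwartzSeminorm_le fun x hx => ?_
      refine le_of_eq_of_le ?_ (schwartzSeminorm_bound 0 p (derivS i (laguerre 𝕜 n)) hx)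
      rw [multiDeriv_add_single p i (schwartz_contDiffOn _) hx,
        ← multiDeriv_pderiv p i (schwartz_contDiffOn _) hx,
        multiDeriv_congr p (fun y hy => derivS_apply i _ hy) hx]
  | hs k i ih =>
    refine (((ih p).comp_mulS i).add
      ((ih (p - Pi.single i 1)).const_mul (Nat.cast_nonneg (p i)))).mono fun n =>
        schwartzSeminorm_le fun x hx => ?_
    set f := laguerre 𝕜 n
    have h1 := schwartzSeminorm_bound k p (mulS i f) hx
    have h2 := schwartzSeminorm_bound k (p - Pi.single i 1) f hx
    -- Leibniz's rule, solved for the term that carries the extra weight `x_i`.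
    have h3 : (x i : 𝕜) * multiDeriv p f x = multiDeriv p (mulS i f) x
        - (p i : 𝕜) * multiDeriv (p - Pi.single i 1) f x := by
      have := multiDeriv_coord_mul i (schwartz_contDiffOn f) p hx
      rw [multiDeriv_congr p (fun y _ => mulS_apply i f y) hx, this]
      ring
    have h4 := prod_pow_nonneg k hx
    have h5 := norm_sub_le (multiDeriv p (mulS i f) x)
      ((p i : 𝕜) * multiDeriv (p - Pi.single i 1) f x)
    rw [← h3, norm_mul, norm_mul, RCLike.norm_ofReal, abs_of_pos (hx i),
      RCLike.norm_natCast] at h5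
    rw [prod_pow_add_single]
    calc _ = (∏ j, x j ^ k j) * (x i * ‖multiDeriv p f x‖) := by ring
      _ ≤ (∏ j, x j ^ k j) * (‖multiDeriv p (mulS i f) x‖
          + p i * ‖multiDeriv (p - Pi.single i 1) f x‖) := by gcongr
      _ = (∏ j, x j ^ k j) * ‖multiDeriv p (mulS i f) x‖
          + p i * ((∏ j, x j ^ k j) * ‖multiDeriv (p - Pi.single i 1) f x‖) := by ring
      _ ≤ _ := by gcongr

theorem polyGrowth_of_continuous {q : Seminorm 𝕜 (SchwartzOrthant 𝕜 d)} (hq : Continuous q) :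
    PolyGrowth 𝕜 q := by
  obtain ⟨s, C, -, hle⟩ := Seminorm.bound_of_continuous (schwartz_withSeminorms 𝕜 d) q hq
  have h1 : PolyBounded fun n => ∑ kp ∈ s, schwartzSeminorm 𝕜 d kp.1 kp.2 (laguerre 𝕜 n) := by
    clear hle
    classical
    induction s using Finset.induction_on with
    | empty => exact ⟨0, 0, le_rfl, fun n => by simp⟩
    | insert kp s hkp ih =>
      simp only [Finset.sum_insert hkp]
      exact (polyGrowth_schwartzSeminorm kp.1 kp.2).add ih
  refine (h1.const_mul C.2).mono fun n => (hle _).trans ?_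
  refine mul_le_mul_of_nonneg_left ?_ C.2
  have := Seminorm.finset_sup_le_sum (schwartzSeminormFamily 𝕜 d) s (laguerre 𝕜 n)
  refine this.trans_eq ?_
  rw [_root_.sum_apply]
  rfl

end Growth

/-! ### The pairing, integration by parts and symmetry. -/

section Integration

open MeasureTheory

variable {𝕜 : Type*} [RCLike 𝕜] {d : ℕ}

theorem measurableSet_orthant (d : ℕ) : MeasurableSet (orthant d) :=
  (isOpen_orthant d).measurableSet

theorem orthant_eq_pi (d : ℕ) : orthant d = Set.univ.pi fun _ => Set.Ioi (0 : ℝ) := by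
  ext x; simp [orthant]

/-- The function `∏ᵢ (1 + x_i²)⁻¹`. -/
def decayFun (x : Fin d → ℝ) : ℝ := ∏ i, (1 + x i ^ 2)⁻¹

theorem decayFun_pos (x : Fin d → ℝ) : 0 < decayFun x :=
  Finset.prod_pos fun _ _ => by positivity

theorem integrable_decayFun : Integrable (decayFun : (Fin d → ℝ) → ℝ) :=
  Integrable.fintype_prod (f := fun (_ : Fin d) (t : ℝ) => (1 + t ^ 2)⁻¹)
    fun _ => integrable_inv_one_add_sq

variable (𝕜 d) in
/-- A continuous seminorm controlling `sup_x |f(x)| ∏ᵢ (1 + x_i²)`. -/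
def decaySeminorm : Seminorm 𝕜 (SchwartzOrthant 𝕜 d) :=
  ∑ t ∈ (Finset.univ : Finset (Fin d)).powerset,
    schwartzSeminorm 𝕜 d (fun i => if i ∈ t then 2 else 0) 0

theorem decaySeminorm_apply (f : SchwartzOrthant 𝕜 d) : decaySeminorm 𝕜 d f =
    ∑ t ∈ (Finset.univ : Finset (Fin d)).powerset,
      schwartzSeminorm 𝕜 d (fun i => if i ∈ t then 2 else 0) 0 f :=
  _root_.sum_apply _ _ _

theorem continuous_decaySeminorm : Continuous (decaySeminorm 𝕜 d) := by
  have : ⇑(decaySeminorm 𝕜 d) = fun f => ∑ t ∈ (Finset.univ : Finset (Fin d)).powerset,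
      schwartzSeminorm 𝕜 d (fun i => if i ∈ t then 2 else 0) 0 f :=
    funext decaySeminorm_apply
  rw [this]
  exact continuous_finsetSum _ fun t _ => continuous_schwartzSeminorm _ _

theorem norm_le_decay (f : SchwartzOrthant 𝕜 d) (x : Fin d → ℝ) :
    ‖f x‖ ≤ decaySeminorm 𝕜 d f * decayFun x := by
  by_cases hx : x ∈ orthant d
  · have h1 : (∏ i, (1 + x i ^ 2)) * ‖f x‖ ≤ decaySeminorm 𝕜 d f := by
      -- The product `∏ (1 + x_i²)` expands over subsets `t`, and each term is the weight of one
      -- summand of `decaySeminorm`.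
      rw [Finset.prod_one_add, Finset.sum_mul, decaySeminorm_apply]
      refine Finset.sum_le_sum fun t _ => ?_
      refine le_of_eq_of_le ?_ (schwartzSeminorm_bound _ 0 f hx)
      rw [multiDeriv_zero_index]
      congr 1
      have : ∀ i, x i ^ (if i ∈ t then 2 else 0) = if i ∈ t then x i ^ 2 else 1 := by
        intro i; split_ifs <;> simp
      simp only [this, Finset.prod_ite_mem, Finset.univ_inter]
    have h2 : (∏ i, (1 + x i ^ 2)) * decayFun x = 1 := by
      rw [decayFun, ← Finset.prod_mul_distrib]
      exact Finset.prod_eq_one fun i _ => mul_inv_cancel₀ (by positivity)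
    calc ‖f x‖ = ((∏ i, (1 + x i ^ 2)) * ‖f x‖) * decayFun x := by
          rw [mul_right_comm, h2, one_mul]
      _ ≤ _ := mul_le_mul_of_nonneg_right h1 (decayFun_pos x).le
  · rw [schwartz_apply_of_notMem f hx, norm_zero]
    exact mul_nonneg (apply_nonneg _ _) (decayFun_pos x).le

theorem norm_apply_le_seminorm (f : SchwartzOrthant 𝕜 d) {x : Fin d → ℝ} (hx : x ∈ orthant d) :
    ‖f x‖ ≤ schwartzSeminorm 𝕜 d 0 0 f := by
  simpa [multiDeriv_zero_index] using norm_multiDeriv_le 0 f hx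

/-- The estimate is deliberately asymmetric: `f` alone supplies the decay that makes the product
integrable, so that `g`, later a Laguerre function, enters only through its sup norm. -/
theorem norm_mul_le_decay (f g : SchwartzOrthant 𝕜 d) (x : Fin d → ℝ) :
    ‖f x * g x‖ ≤ decaySeminorm 𝕜 d f * schwartzSeminorm 𝕜 d 0 0 g * decayFun x := by
  rw [norm_mul, mul_right_comm]
  by_cases hx : x ∈ orthant d
  · exact mul_le_mul (norm_le_decay f x) (norm_apply_le_seminorm g hx) (norm_nonneg _)
      (mul_nonneg (apply_nonneg _ _) (decayFun_pos x).le)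
  · rw [schwartz_apply_of_notMem g hx, norm_zero, mul_zero]
    have := (decayFun_pos x).le
    positivity

theorem aestronglyMeasurable_schwartz (f : SchwartzOrthant 𝕜 d) :
    AEStronglyMeasurable f (volume.restrict (orthant d)) :=
  (schwartz_contDiffOn f).continuousOn.aestronglyMeasurable (measurableSet_orthant d)

theorem integrableOn_schwartz_mul (f g : SchwartzOrthant 𝕜 d) :
    IntegrableOn (fun x => f x * g x) (orthant d) :=
  Integrable.mono' ((integrable_decayFun.const_mul _).integrableOn)
    ((aestronglyMeasurable_schwartz f).mul (aestronglyMeasurable_schwartz g))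
    (Filter.Eventually.of_forall fun x => norm_mul_le_decay f g x)

/-- The bilinear pairing `∫ f g` over the orthant, as a linear functional of `f`. -/
def pairing (g : SchwartzOrthant 𝕜 d) : SchwartzOrthant 𝕜 d →ₗ[𝕜] 𝕜 where
  toFun f := ∫ x in orthant d, f x * g x
  map_add' f f' := by
    simp only [schwartz_add_apply, add_mul]
    exact integral_add (integrableOn_schwartz_mul f g) (integrableOn_schwartz_mul f' g)
  map_smul' c f := by
    simp only [schwartz_smul_apply, mul_assoc]
    exact integral_const_mul _ _

theorem pairing_apply (g f : SchwartzOrthant 𝕜 d) : pairing g f = ∫ x in orthant d, f x * g x :=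
  rfl

theorem pairing_comm (f g : SchwartzOrthant 𝕜 d) : pairing g f = pairing f g := by
  simp only [pairing_apply, mul_comm]

theorem pairing_mulS (i : Fin d) (f g : SchwartzOrthant 𝕜 d) :
    pairing g (mulS i f) = pairing (mulS i g) f := by
  simp only [pairing_apply, mulS_apply]
  congr 1
  funext x
  ring

theorem norm_pairing_le (f g : SchwartzOrthant 𝕜 d) : ‖pairing g f‖ ≤
    (∫ x : Fin d → ℝ, decayFun x) * (decaySeminorm 𝕜 d f * schwartzSeminorm 𝕜 d 0 0 g) := by
  rw [pairing_apply, mul_comm, ← integral_const_mul]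
  refine (norm_integral_le_of_norm_le ((integrable_decayFun.const_mul _).integrableOn)
    (Filter.Eventually.of_forall fun x => norm_mul_le_decay f g x)).trans ?_
  refine setIntegral_le_integral (integrable_decayFun.const_mul _)
    (Filter.Eventually.of_forall fun x => ?_)
  exact mul_nonneg (mul_nonneg (apply_nonneg _ _) (apply_nonneg _ _)) (decayFun_pos x).le

theorem hasDerivAt_insertNth {m : ℕ} (i : Fin (m + 1)) (y : Fin m → ℝ) (t : ℝ) :
    HasDerivAt (fun s : ℝ => (i.insertNth s y : Fin (m + 1) → ℝ)) (Pi.single i 1) t := by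
  rw [hasDerivAt_pi]
  intro j
  refine Fin.succAboveCases i ?_ (fun j => ?_) j
  · simpa using hasDerivAt_id' t
  · simpa using hasDerivAt_const t (y j)

/-- If `h` vanishes on the face `x_i = 0` and at infinity, then `∫ ∂_i h = 0`. -/
theorem integral_pderiv_eq_zero (i : Fin d) {h : (Fin d → ℝ) → 𝕜} {C : ℝ}
    (hd : ∀ x ∈ orthant d, DifferentiableAt ℝ h x)
    (hint : IntegrableOn (pderiv i h) (orthant d))
    (h1 : ∀ x ∈ orthant d, ‖h x‖ ≤ C * x i) (h2 : ∀ x ∈ orthant d, ‖h x‖ ≤ C / x i) :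
    ∫ x in orthant d, pderiv i h x = 0 := by
  obtain _ | m := d
  · exact i.elim0
  -- Fubini: the `i`-th coordinate is split off, and for almost every value of the others the
  -- integral over `x_i` is shown to vanish.
  have hmp := (volume_preserving_piFinSuccAbove (fun _ : Fin (m + 1) => ℝ) i).symm
  set e := MeasurableEquiv.piFinSuccAbove (fun _ : Fin (m + 1) => ℝ) i
  have he : ∀ z, e.symm z = i.insertNth z.1 z.2 := fun z => rfl
  have hpre : e.symm ⁻¹' orthant (m + 1) = Set.Ioi 0 ×ˢ orthant m := by
    ext z
    simp only [Set.mem_preimage, he, orthant, Set.mem_ofPred_eq, Set.mem_prod, Set.mem_Ioi]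
    rw [Fin.forall_iff_succAbove i]
    simp
  have hmem : ∀ t : ℝ, 0 < t → ∀ y ∈ orthant m, (i.insertNth t y : Fin (m + 1) → ℝ)
      ∈ orthant (m + 1) := by
    intro t ht y hy
    have : ((t, y) : ℝ × (Fin m → ℝ)) ∈ e.symm ⁻¹' orthant (m + 1) := by
      rw [hpre]; exact ⟨ht, hy⟩
    exact this
  have hint' : Integrable (fun z : ℝ × (Fin m → ℝ) => pderiv i h (i.insertNth z.1 z.2))
      ((volume.restrict (Set.Ioi 0)).prod (volume.restrict (orthant m))) := by
    rw [Measure.prod_restrict, ← Measure.volume_eq_prod, ← hpre]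
    exact (hmp.integrableOn_comp_preimage e.symm.measurableEmbedding).2 hint
  rw [← hmp.setIntegral_preimage_emb e.symm.measurableEmbedding, hpre, Measure.volume_eq_prod,
    ← Measure.prod_restrict]
  simp only [he]
  rw [integral_prod_symm _ hint']
  refine integral_eq_zero_of_ae ?_
  filter_upwards [hint'.prod_left_ae, ae_restrict_mem (measurableSet_orthant m)] with y hy hym
  -- The slice is extended by zero to `t ≤ 0`. The bound `C * t` makes it continuous at `0` from the
  -- right, and `C / t` makes it vanish at infinity.
  set φ : ℝ → 𝕜 := fun t => if 0 < t then h (i.insertNth t y) else 0 with hφ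
  have hφ0 : φ 0 = 0 := by simp [hφ]
  have hφ1 : ∀ t, 0 ≤ t → ‖φ t‖ ≤ C * t := by
    intro t ht
    rcases ht.eq_or_lt with rfl | ht
    · simp [hφ]
    · simpa [hφ, ht] using h1 _ (hmem t ht y hym)
  have hcont : ContinuousWithinAt φ (Set.Ici 0) 0 := by
    rw [ContinuousWithinAt, hφ0]
    refine squeeze_zero_norm' (a := fun t => C * t)
      (Filter.eventually_of_mem self_mem_nhdsWithin fun t ht => hφ1 t ht) ?_
    have : Filter.Tendsto (fun t : ℝ => C * t) (nhds 0) (nhds (C * 0)) :=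
      (continuous_const_mul C).tendsto 0
    rw [mul_zero] at this
    exact this.mono_left nhdsWithin_le_nhds
  have hder : ∀ t ∈ Set.Ioi (0 : ℝ), HasDerivAt φ (pderiv i h (i.insertNth t y)) t := by
    intro t ht
    have h3 := (hd _ (hmem t ht y hym)).hasFDerivAt.comp_hasDerivAt t (hasDerivAt_insertNth i y t)
    refine h3.congr_of_eventuallyEq ?_
    filter_upwards [Ioi_mem_nhds ht] with s hs
    exact if_pos hs
  have hlim : Filter.Tendsto φ Filter.atTop (nhds 0) := by
    refine squeeze_zero_norm' (a := fun t => C / t) ?_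
      (Filter.Tendsto.const_div_atTop Filter.tendsto_id C)
    filter_upwards [Filter.eventually_gt_atTop 0] with t ht
    simpa [hφ, ht] using h2 _ (hmem t ht y hym)
  have := integral_Ioi_of_hasDerivAt_of_tendsto hcont hder hy hlim
  simpa [hφ0] using this

/-- The factor `x_i` in `mulS i f` kills the boundary term on the face `x_i = 0`, so `g` need not
vanish there. -/
theorem pairing_derivS_mulS (i : Fin d) (f g : SchwartzOrthant 𝕜 d) :
    pairing g (derivS i (mulS i f)) = -pairing (derivS i g) (mulS i f) := by
  set F := mulS i f with hF
  have hdf : ∀ x ∈ orthant d, DifferentiableAt ℝ F x := fun x hx =>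
    differentiableAt_of_contDiffOn (schwartz_contDiffOn F) hx
  have hdg : ∀ x ∈ orthant d, DifferentiableAt ℝ g x := fun x hx =>
    differentiableAt_of_contDiffOn (schwartz_contDiffOn g) hx
  have hprod : Set.EqOn (pderiv i fun x => F x * g x)
      (fun x => derivS i F x * g x + F x * derivS i g x) (orthant d) := by
    intro x hx
    simp only [derivS_apply i _ hx, pderiv]
    rw [fderiv_fun_mul (hdf x hx) (hdg x hx)]
    simp
    ring
  have hi1 := integrableOn_schwartz_mul (derivS i F) g
  have hi2 := integrableOn_schwartz_mul F (derivS i g)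
  set A := schwartzSeminorm 𝕜 d 0 0 f
  set A' := schwartzSeminorm 𝕜 d 0 0 (mulS i F)
  set B := schwartzSeminorm 𝕜 d 0 0 g
  have hA : 0 ≤ A := apply_nonneg _ _
  have hA' : 0 ≤ A' := apply_nonneg _ _
  have hB : 0 ≤ B := apply_nonneg _ _
  -- One constant serves both bounds: `A` controls the product near the face, `A'` controls it at
  -- infinity.
  have key := integral_pderiv_eq_zero i (h := fun x => F x * g x) (C := (A + A') * B)
    (fun x hx => (hdf x hx).fun_mul (hdg x hx))
    ((hi1.add hi2).congr_fun hprod.symm (measurableSet_orthant d))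
    (fun x hx => by
      have h1 := norm_apply_le_seminorm f hx
      have h2 := norm_apply_le_seminorm g hx
      have h3 := hx i
      rw [norm_mul, hF, mulS_apply, norm_mul, RCLike.norm_ofReal, abs_of_pos h3]
      calc x i * ‖f x‖ * ‖g x‖ ≤ x i * (A + A') * B := by
            gcongr
            linarith
        _ = _ := by ring)
    (fun x hx => by
      have h1 := norm_apply_le_seminorm (mulS i F) hx
      have h2 := norm_apply_le_seminorm g hx
      have h3 := hx i
      rw [mulS_apply, norm_mul, RCLike.norm_ofReal, abs_of_pos h3] at h1
      rw [le_div_iff₀ h3, norm_mul]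
      calc ‖F x‖ * ‖g x‖ * x i = x i * ‖F x‖ * ‖g x‖ := by ring
        _ ≤ (A + A') * B := by
            gcongr
            linarith)
  rw [setIntegral_congr_fun (measurableSet_orthant d) hprod, integral_add hi1 hi2] at key
  exact eq_neg_of_add_eq_zero_left key

/-- Moving both derivatives across the pairing is free of boundary terms, since the multiplication
by `x_i` stands between them. -/
theorem pairing_laguerreOp (i : Fin d) (f g : SchwartzOrthant 𝕜 d) :
    pairing g (laguerreOp 𝕜 i f) = pairing (laguerreOp 𝕜 i g) f := by
  rw [pairing_comm f (laguerreOp 𝕜 i g)]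
  simp only [laguerreOp, _root_.sub_apply, _root_.smul_apply, ContinuousLinearMap.comp_apply,
    map_sub, map_smul]
  rw [pairing_derivS_mulS, pairing_derivS_mulS, pairing_mulS, pairing_mulS, pairing_comm (mulS i g),
    pairing_comm (mulS i (derivS i g)), ← pairing_mulS, ← pairing_mulS, pairing_mulS]

end Integration

/-! ### Rapid decay of the Laguerre coefficients. -/

section Coefficients

open MeasureTheory

variable {𝕜 : Type*} [RCLike 𝕜] {d : ℕ}

theorem coeff_eq_pairing (f : SchwartzOrthant 𝕜 d) (n : Fin d → ℕ) :
    coeff f n = pairing (laguerre 𝕜 n) f := rfl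

variable (𝕜 d) in
/-- The operator whose eigenvalue on `𝓛_n` is `1 + |n|`. -/
def weightOp : SchwartzOrthant 𝕜 d →L[𝕜] SchwartzOrthant 𝕜 d :=
  ((1 - d / 2 : ℝ) : 𝕜) • ContinuousLinearMap.id 𝕜 _ + ∑ i, laguerreOp 𝕜 i

theorem weightOp_apply (f : SchwartzOrthant 𝕜 d) :
    weightOp 𝕜 d f = ((1 - d / 2 : ℝ) : 𝕜) • f + ∑ i, laguerreOp 𝕜 i f := by
  simp [weightOp]

theorem pairing_weightOp (f g : SchwartzOrthant 𝕜 d) :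
    pairing g (weightOp 𝕜 d f) = pairing (weightOp 𝕜 d g) f := by
  rw [pairing_comm f (weightOp 𝕜 d g)]
  simp only [weightOp_apply, map_add, map_smul, map_sum, pairing_laguerreOp]
  rw [pairing_comm f g]
  congr 1
  exact Finset.sum_congr rfl fun i _ => by rw [pairing_comm f, pairing_laguerreOp]

/-- The eigenvalues `n_i + 1/2` add up to `|n| + d/2`; the constant `1 - d/2` corrects this to `1 +
|n|`. -/
theorem weightOp_laguerre (n : Fin d → ℕ) :
    weightOp 𝕜 d (laguerre 𝕜 n) = (indexWeight n : 𝕜) • laguerre 𝕜 n := by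
  rw [weightOp_apply]
  simp only [laguerreOp_laguerre]
  rw [← Finset.sum_smul, ← add_smul, ← RCLike.ofReal_sum, ← RCLike.ofReal_add]
  congr 2
  rw [Finset.sum_add_distrib, indexWeight]
  simp
  ring

/-- By symmetry the operator passes to `𝓛_n`, where it acts as a scalar. -/
theorem coeff_weightOp_iterate (k : ℕ) (f : SchwartzOrthant 𝕜 d) (n : Fin d → ℕ) :
    coeff ((weightOp 𝕜 d ^ k) f) n = (indexWeight n : 𝕜) ^ k * coeff f n := by
  induction k with
  | zero => simp
  | succ k ih =>
    rw [pow_succ', mul_apply_eq_comp, coeff_eq_pairing, pairing_weightOp,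
      weightOp_laguerre, pairing_comm, map_smul, pairing_comm, ← coeff_eq_pairing, ih, smul_eq_mul]
    ring

/-- The Laguerre coefficients decrease rapidly, with continuous dependence on the function. -/
theorem exists_coeff_bound (𝕜 : Type*) [RCLike 𝕜] (d k : ℕ) :
    ∃ q : Seminorm 𝕜 (SchwartzOrthant 𝕜 d), Continuous q ∧
      ∀ f n, ‖coeff f n‖ * indexWeight n ^ k ≤ q f := by
  obtain ⟨C, M, hC, hb⟩ := polyGrowth_schwartzSeminorm (𝕜 := 𝕜) (d := d) 0 0
  set K := ∫ x : Fin d → ℝ, decayFun x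
  have hK : 0 ≤ K := integral_nonneg fun x => (decayFun_pos x).le
  -- The `M` additional powers absorb the growth of the sup norm of `𝓛_n`.
  set T := weightOp 𝕜 d ^ (k + M)
  let c : NNReal := ⟨K * C, by positivity⟩
  refine ⟨c • (decaySeminorm 𝕜 d).comp T.toLinearMap,
    (continuous_decaySeminorm.comp T.continuous).const_smul _, fun f n => ?_⟩
  have h1 := norm_pairing_le (T f) (laguerre 𝕜 n)
  have hw := indexWeight_pos n
  rw [← coeff_eq_pairing, coeff_weightOp_iterate, norm_mul, norm_pow, RCLike.norm_ofReal,
    abs_of_pos hw, pow_add] at h1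
  have h2 : indexWeight n ^ M * (‖coeff f n‖ * indexWeight n ^ k)
      ≤ indexWeight n ^ M * (K * C * decaySeminorm 𝕜 d (T f)) := by
    calc _ = indexWeight n ^ k * indexWeight n ^ M * ‖coeff f n‖ := by ring
      _ ≤ _ := h1
      _ ≤ K * (decaySeminorm 𝕜 d (T f) * (C * indexWeight n ^ M)) := by
        gcongr
        exact hb n
      _ = _ := by ring
  exact le_of_mul_le_mul_left h2 (by positivity)

theorem coeff_laguerre (n m : Fin d → ℕ) :
    coeff (laguerre 𝕜 n) m = if n = m then 1 else 0 := by
  have h1 : coeff (laguerre 𝕜 n) m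
      = ∫ x in orthant d, ∏ i, ((laguerreFun (n i) (x i) * laguerreFun (m i) (x i) : ℝ) : 𝕜) := by
    refine setIntegral_congr_fun (measurableSet_orthant d) fun x hx => ?_
    simp only [laguerre_apply 𝕜 _ hx]
    rw [← RCLike.ofReal_mul, ← Finset.prod_mul_distrib, RCLike.ofReal_prod]
  rw [h1, orthant_eq_pi, volume_pi, Measure.restrict_pi_pi, integral_fintype_prod_eq_prod
    (fun i (t : ℝ) => ((laguerreFun (n i) t * laguerreFun (m i) t : ℝ) : 𝕜))]
  simp only [integral_ofReal, (integrableOn_laguerreFun_mul _ _).2]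
  split_ifs with h
  · simp [h]
  · obtain ⟨i, hi⟩ := Function.ne_iff.1 h
    exact Finset.prod_eq_zero (Finset.mem_univ i) (by simp [hi])

end Coefficients

/-! ### Products of absolutely convergent series. -/

section ProductSeries

theorem hasSum_of_eq {α M : Type*} [AddCommMonoid M] [TopologicalSpace M] {f g : α → M} {a : M}
    (h : HasSum f a) (hfg : ∀ i, f i = g i) : HasSum g a :=
  funext hfg ▸ h

theorem hasSum_pi_prod {R : Type*} [NormedField R] [CompleteSpace R] {d : ℕ} {f : Fin d → ℕ → R}
    {a : Fin d → R} (hf : ∀ i, Summable fun m => ‖f i m‖) (ha : ∀ i, HasSum (f i) (a i)) :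
    Summable (fun n : Fin d → ℕ => ‖∏ i, f i (n i)‖) ∧
      HasSum (fun n : Fin d → ℕ => ∏ i, f i (n i)) (∏ i, a i) := by
  induction d with
  | zero =>
    refine ⟨(hasSum_fintype _).summable, ?_⟩
    simp
  | succ d ih =>
    obtain ⟨h1, h2⟩ := ih (f := fun i => f i.succ) (fun i => hf i.succ) (fun i => ha i.succ)
    have h3 : Summable fun z : ℕ × (Fin d → ℕ) => ‖f 0 z.1 * ∏ i : Fin d, f i.succ (z.2 i)‖ :=
      Summable.mul_norm (f := f 0) (g := fun n : Fin d → ℕ => ∏ i : Fin d, f i.succ (n i))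
        (hf 0) h1
    have h4 := (ha 0).mul h2 h3.of_norm
    let e : ℕ × (Fin d → ℕ) ≃ (Fin (d + 1) → ℕ) := Fin.consEquiv fun _ : Fin (d + 1) => ℕ
    have he : ∀ z, ∏ i, f i (e z i) = f 0 z.1 * ∏ i : Fin d, f i.succ (z.2 i) := fun z =>
      Fin.prod_univ_succ _
    rw [Fin.prod_univ_succ, ← e.summable_iff, ← e.hasSum_iff]
    simp only [Function.comp_def, he]
    exact ⟨h3, h4⟩

end ProductSeries

/-! ### The generating function and the expansion of exponentials. -/

section GeneratingFunction

open Polynomial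

/-- With the explicit coefficients and `n = m + k` this is an absolutely convergent double series.
The sum over `m` is the binomial series `∑ (m+k choose k) r^m = (1 - r)^{-(k+1)}`, and the sum over
`k` is then an exponential series. -/
theorem hasSum_laguerreP_generating {r : ℂ} (hr : ‖r‖ < 1) (x : ℝ) :
    HasSum (fun n : ℕ => r ^ n * (((laguerreP n).eval x : ℝ) : ℂ))
      ((1 - r)⁻¹ * Complex.exp (-x * r / (1 - r))) := by
  have hr1 : 1 - r ≠ 0 := by
    intro h
    rw [← sub_eq_zero.1 h] at hr
    simp at hr
  obtain ⟨g, hg⟩ : ∃ g : ℕ × ℕ → ℂ, ∀ k m, g (k, m) =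
      (r ^ k * (-x : ℂ) ^ k / (k.factorial : ℂ)) * (((m + k).choose k : ℂ) * r ^ m) :=
    ⟨fun z => (r ^ z.1 * (-x : ℂ) ^ z.1 / (z.1.factorial : ℂ))
      * (((z.2 + z.1).choose z.1 : ℂ) * r ^ z.2), fun _ _ => rfl⟩
  have hfib : ∀ k, HasSum (fun m => g (k, m))
      ((r ^ k * (-x : ℂ) ^ k / (k.factorial : ℂ)) * (1 / (1 - r) ^ (k + 1))) := fun k =>
    hasSum_of_eq ((hasSum_choose_mul_geometric_of_norm_lt_one k hr).mul_left _)
      fun m => (hg k m).symm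
  have hexp : ∀ y : ℂ, HasSum (fun k : ℕ => y ^ k / (k.factorial : ℂ)) (Complex.exp y) := by
    intro y
    have := NormedSpace.expSeries_div_hasSum_exp y
    rwa [← Complex.exp_eq_exp_ℂ] at this
  have hout : HasSum (fun k : ℕ => (r ^ k * (-x : ℂ) ^ k / (k.factorial : ℂ))
      * (1 / (1 - r) ^ (k + 1))) ((1 - r)⁻¹ * Complex.exp (-x * r / (1 - r))) := by
    refine hasSum_of_eq ((hexp (-x * r / (1 - r))).mul_left (1 - r)⁻¹) fun k => ?_
    have : (k.factorial : ℂ) ≠ 0 := by exact_mod_cast k.factorial_ne_zero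
    rw [div_pow, mul_pow, pow_succ]
    field_simp
  -- The norms can be summed in the same way, with `‖r‖` and `|x|` in place of `r` and `-x`.
  have hsum : Summable g := by
    refine Summable.of_norm ((summable_prod_of_nonneg fun _ => norm_nonneg _).2 ⟨fun k => ?_, ?_⟩)
    · exact (hfib k).summable.norm
    · have hr' : ‖‖r‖‖ < 1 := by simpa using hr
      have h1 : ∀ k, HasSum (fun m => ‖g (k, m)‖)
          ((‖r‖ ^ k * |x| ^ k / (k.factorial : ℝ)) * (1 / (1 - ‖r‖) ^ (k + 1))) := by
        intro k
        refine hasSum_of_eq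
          ((hasSum_choose_mul_geometric_of_norm_lt_one k hr').mul_left _) fun m => ?_
        rw [hg]
        simp
      simp only [(h1 _).tsum_eq]
      have h2 := (NormedSpace.expSeries_div_summable (‖r‖ * |x| / (1 - ‖r‖))).mul_right
        (1 - ‖r‖)⁻¹
      refine h2.congr fun k => ?_
      have h3 : (1 - ‖r‖) ≠ 0 := by linarith
      have : (k.factorial : ℝ) ≠ 0 := by exact_mod_cast k.factorial_ne_zero
      rw [div_pow, mul_pow, pow_succ]
      field_simp
  have htot : HasSum g ((1 - r)⁻¹ * Complex.exp (-x * r / (1 - r))) := by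
    rw [← (hsum.hasSum.prod_fiberwise hfib).unique hout]
    exact hsum.hasSum
  -- Regrouping the double series by `n = k + m` yields `r^n L_n(x)`.
  have hanti := (Finset.HasAntidiagonal.sigmaAntidiagonalEquivProd.hasSum_iff.2 htot).sigma
    (fun n => (Finset.HasAntidiagonal.antidiagonal n).hasSum g)
  refine hasSum_of_eq hanti fun n => ?_
  rw [Finset.Nat.sum_antidiagonal_eq_sum_range_succ_mk, eval_laguerreP]
  push_cast
  rw [Finset.mul_sum]
  refine Finset.sum_congr rfl fun k hk => ?_
  have hk' : k ≤ n := by simpa [Nat.lt_succ_iff] using hk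
  rw [hg, Nat.sub_add_cancel hk']
  rw [neg_pow (x : ℂ) k, ← pow_mul_pow_sub r hk']
  ring

theorem norm_fourierParam_lt_one (ξ : ℝ) :
    ‖(ξ * Complex.I) / (1 + ξ * Complex.I)‖ < 1 := by
  have h : ‖(ξ * Complex.I : ℂ)‖ < ‖(1 + ξ * Complex.I : ℂ)‖ := by
    rw [Complex.norm_def, Complex.norm_def]
    refine Real.sqrt_lt_sqrt (Complex.normSq_nonneg _) ?_
    simp [Complex.normSq_apply]
  rw [norm_div]
  exact (div_lt_one ((norm_nonneg _).trans_lt h)).2 h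

/-- Expansion of `e^{-x/2 - iξx}` into Laguerre functions. -/
theorem hasSum_exp_laguerreFun (ξ : ℝ) :
    ∃ c : ℕ → ℂ, (∀ B : ℕ, Summable fun m => ‖c m‖ * ((m : ℝ) + B)) ∧
      ∀ x : ℝ, HasSum (fun m => c m * (laguerreFun m x : ℂ))
        (Complex.exp (-(ξ * x) * Complex.I - x / 2)) := by
  -- This `r` solves `r / (1 - r) = iξ`, so the generating function produces `e^{-iξx}`.
  set r : ℂ := (ξ * Complex.I) / (1 + ξ * Complex.I) with hr
  have hr1 : ‖r‖ < 1 := norm_fourierParam_lt_one ξ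
  have hden : (1 + ξ * Complex.I : ℂ) ≠ 0 := by
    intro h
    have := congrArg Complex.re h
    simp at this
  have h1r : 1 - r = (1 + ξ * Complex.I)⁻¹ := by
    rw [hr]; field_simp; ring
  refine ⟨fun m => (1 - r) * r ^ m, fun B => ?_, fun x => ?_⟩
  · have hr' : ‖‖r‖‖ < 1 := by simpa using hr1
    have h1 := summable_pow_mul_geometric_of_norm_lt_one 1 hr'
    have h2 := summable_geometric_of_norm_lt_one hr'
    refine ((h1.add (h2.mul_left (B : ℝ))).mul_left ‖1 - r‖).congr fun m => ?_
    rw [norm_mul, norm_pow]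
    ring
  · have h := ((hasSum_laguerreP_generating hr1 x).mul_left (1 - r)).mul_right
      (Complex.exp (-x / 2))
    have h2 : (1 - r) * ((1 - r)⁻¹ * Complex.exp (-x * r / (1 - r))) * Complex.exp (-x / 2)
        = Complex.exp (-(ξ * x) * Complex.I - x / 2) := by
      rw [mul_inv_cancel_left₀ (by rw [h1r]; exact inv_ne_zero hden), ← Complex.exp_add]
      congr 1
      rw [h1r, hr]
      field_simp
      ring
    rw [h2] at h
    refine hasSum_of_eq h fun m => ?_
    rw [laguerreFun_eq_eval]
    push_cast
    ring

end GeneratingFunction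

/-! ### Uniqueness of the coefficients by Fourier inversion. -/

section Uniqueness

open MeasureTheory

variable {𝕜 : Type*} [RCLike 𝕜] {d : ℕ}

/-- The exponential is expanded into Laguerre functions and integrated term by term. The real-linear
`φ` treats real and complex scalars alike; it passes through the integral and the real factor `𝓛_n`.
-/
theorem integral_exp_eq_zero {f : SchwartzOrthant 𝕜 d} (hf : ∀ n, coeff f n = 0) (φ : 𝕜 →L[ℝ] ℂ)
    (ξ : Fin d → ℝ) : ∫ x in orthant d,
      φ (f x) * ∏ i, Complex.exp (-(ξ i * x i) * Complex.I - x i / 2) = 0 := by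
  choose c hc hsum using fun i => hasSum_exp_laguerreFun (ξ i)
  have hB := (hasSum_pi_prod (f := fun i m => ‖c i m‖ * ((m : ℝ) + (2 : ℕ)))
    (fun i => (hc i 2).norm) fun i => (hc i 2).hasSum).2.summable
  have hcoef : ∀ n : Fin d → ℕ, ∫ x in orthant d,
      φ (f x) * ∏ i, (c i (n i) * (laguerreFun (n i) (x i) : ℂ)) = 0 := by
    intro n
    have h1 : φ (coeff f n) = ∫ x in orthant d, φ (f x * laguerre 𝕜 n x) :=
      (φ.integral_comp_comm (integrableOn_schwartz_mul f (laguerre 𝕜 n))).symm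
    rw [hf n, map_zero] at h1
    have h2 : ∫ x in orthant d, φ (f x) * ∏ i, (c i (n i) * (laguerreFun (n i) (x i) : ℂ))
        = ∫ x in orthant d, (∏ i, c i (n i)) * φ (f x * laguerre 𝕜 n x) := by
      refine setIntegral_congr_fun (measurableSet_orthant d) fun x hx => ?_
      rw [laguerre_apply 𝕜 n hx, mul_comm (f x), ← RCLike.real_smul_eq_coe_mul, map_smul,
        Finset.prod_mul_distrib, Complex.real_smul]
      push_cast
      ring
    rw [h2, integral_const_mul, ← h1, mul_zero]
  have hmeas : AEStronglyMeasurable (fun x => φ (f x)) (volume.restrict (orthant d)) :=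
    φ.continuous.comp_aestronglyMeasurable (aestronglyMeasurable_schwartz f)
  have hcontL : ∀ m, Continuous fun t : ℝ => laguerreFun m t := by
    intro m
    simp only [laguerreFun_eq_eval]
    fun_prop
  -- The bound combines `|𝓛_m| ≤ m + 2`, which the coefficients `c` still sum, with the integrable
  -- decay of `f`.
  have key := hasSum_integral_of_dominated_convergence (μ := volume.restrict (orthant d))
    (F := fun (n : Fin d → ℕ) x => φ (f x) * ∏ i, (c i (n i) * (laguerreFun (n i) (x i) : ℂ)))
    (f := fun x => φ (f x) * ∏ i, Complex.exp (-(ξ i * x i) * Complex.I - x i / 2))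
    (bound := fun n x => (∏ i, ‖c i (n i)‖ * ((n i : ℝ) + (2 : ℕ)))
      * (‖φ‖ * (decaySeminorm 𝕜 d f * decayFun x)))
    (fun n => hmeas.mul (Continuous.aestronglyMeasurable (by
      refine continuous_finsetProd _ fun i _ => continuous_const.mul ?_
      exact Complex.continuous_ofReal.comp ((hcontL (n i)).comp (continuous_apply i)))))
    (fun n => by
      filter_upwards [ae_restrict_mem (measurableSet_orthant d)] with x hx
      rw [norm_mul, norm_prod, mul_comm]
      have h1 : ‖φ (f x)‖ ≤ ‖φ‖ * (decaySeminorm 𝕜 d f * decayFun x) :=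
        (φ.le_opNorm _).trans (mul_le_mul_of_nonneg_left (norm_le_decay f x) (norm_nonneg _))
      refine mul_le_mul (Finset.prod_le_prod (fun _ _ => norm_nonneg _) fun i _ => ?_) h1
        (norm_nonneg _) (Finset.prod_nonneg fun _ _ => by positivity)
      rw [norm_mul, Complex.norm_real]
      refine mul_le_mul_of_nonneg_left ?_ (norm_nonneg _)
      exact_mod_cast abs_laguerreFun_le (n i) (hx i))
    (Filter.Eventually.of_forall fun x => hB.mul_right _)
    (by
      simp only [tsum_mul_right]
      exact (((integrable_decayFun.const_mul _).const_mul _).const_mul _).integrableOn)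
    (by
      filter_upwards [ae_restrict_mem (measurableSet_orthant d)] with x hx
      refine HasSum.mul_left _ (hasSum_pi_prod
        (f := fun i m => c i m * (laguerreFun m (x i) : ℂ)) (fun i => ?_)
        fun i => hsum i (x i)).2
      refine Summable.of_nonneg_of_le (fun _ => norm_nonneg _) (fun m => ?_) (hc i 2)
      rw [norm_mul, Complex.norm_real]
      refine mul_le_mul_of_nonneg_left ?_ (norm_nonneg _)
      exact_mod_cast abs_laguerreFun_le m (hx i))
  simp only [hcoef] at key
  exact key.unique hasSum_zero

/-- The function `G`, zero off the orthant, is integrable with vanishing Fourier transform. It may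
jump at the boundary, but inversion is needed only at interior points, where it is continuous; the
exponential factor never vanishes. -/
theorem apply_eq_zero_of_coeff_eq_zero {f : SchwartzOrthant 𝕜 d} (hf : ∀ n, coeff f n = 0)
    (φ : 𝕜 →L[ℝ] ℂ) {x : Fin d → ℝ} (hx : x ∈ orthant d) : φ (f x) = 0 := by
  let G : (Fin d → ℝ) → ℂ := fun x => φ (f x) * ∏ i, Complex.exp (-(x i : ℂ) / 2)
  have hGoff : ∀ x, x ∉ orthant d → G x = 0 := fun x hx => by
    simp [G, schwartz_apply_of_notMem f hx]
  have hcont : Continuous fun x : Fin d → ℝ => ∏ i, Complex.exp (-(x i : ℂ) / 2) := by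
    refine continuous_finsetProd _ fun i _ => ?_
    fun_prop
  have hGint : Integrable G := by
    rw [← integrableOn_iff_integrable_of_support_subset (s := orthant d)
      (fun x hx => by by_contra h; exact hx (hGoff x h))]
    refine Integrable.mono' (g := fun x => ‖φ‖ * (decaySeminorm 𝕜 d f * decayFun x))
      (((integrable_decayFun.const_mul _).const_mul _).integrableOn)
      ((φ.continuous.comp_aestronglyMeasurable (aestronglyMeasurable_schwartz f)).mul
        hcont.aestronglyMeasurable) ?_
    filter_upwards [ae_restrict_mem (measurableSet_orthant d)] with y hy
    have h1 : ‖φ (f y)‖ ≤ ‖φ‖ * (decaySeminorm 𝕜 d f * decayFun y) :=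
      (φ.le_opNorm _).trans (mul_le_mul_of_nonneg_left (norm_le_decay f y) (norm_nonneg _))
    have h2 : ‖∏ i, Complex.exp (-(y i : ℂ) / 2)‖ ≤ 1 := by
      rw [norm_prod]
      refine Finset.prod_le_one (fun _ _ => norm_nonneg _) fun i _ => ?_
      rw [Complex.norm_exp, Real.exp_le_one_iff]
      have : (-(y i : ℂ) / 2).re = -y i / 2 := by
        rw [← Complex.ofReal_neg, ← Complex.ofReal_ofNat, ← Complex.ofReal_div, Complex.ofReal_re]
      rw [this]
      linarith [hy i]
    rw [norm_mul]
    exact (mul_le_of_le_one_right (norm_nonneg _) h2).trans h1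
  have hmp := PiLp.volume_preserving_ofLp (Fin d)
  have hemb : MeasurableEmbedding (WithLp.ofLp : EuclideanSpace ℝ (Fin d) → Fin d → ℝ) :=
    (MeasurableEquiv.toLp 2 (Fin d → ℝ)).symm.measurableEmbedding
  -- The Fourier transform requires an inner product; the change of norm preserves the measure.
  let H : EuclideanSpace ℝ (Fin d) → ℂ := fun v => G (WithLp.ofLp v)
  have hHint : Integrable H := (hmp.integrable_comp_emb hemb).2 hGint
  have hF : FourierTransform.fourier H = 0 := by
    funext w
    rw [Real.fourier_eq']
    have h1 := hmp.integral_comp hemb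
      (fun y => Complex.exp ((-2 * Real.pi * ∑ i, y i * w i : ℝ) * Complex.I) • G y)
    have h2 : ∀ v : EuclideanSpace ℝ (Fin d), (inner ℝ v w : ℝ) = ∑ i, v i * w i := by
      intro v
      simp [PiLp.inner_apply, mul_comm]
    simp only [h2]
    refine h1.trans ?_
    rw [← setIntegral_eq_integral_of_forall_compl_eq_zero (s := orthant d)
      (fun y hy => by rw [hGoff y hy, smul_zero])]
    -- The Fourier kernel is `e^{-2πi⟨y, w⟩}`, hence the frequencies `ξ_i = 2π w_i`.
    refine Eq.trans ?_ (integral_exp_eq_zero hf φ fun i => 2 * Real.pi * w i)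
    congr 1
    funext y
    simp only [G, smul_eq_mul]
    rw [mul_left_comm]
    congr 1
    rw [← Complex.exp_sum, ← Complex.exp_sum, ← Complex.exp_add]
    congr 1
    push_cast
    rw [Finset.mul_sum, Finset.sum_mul, ← Finset.sum_add_distrib]
    refine Finset.sum_congr rfl fun i _ => ?_
    ring
  have hc : ContinuousAt H (WithLp.toLp 2 x) := by
    have h1 : ContinuousAt G x := by
      refine ContinuousAt.mul ?_ hcont.continuousAt
      exact φ.continuous.continuousAt.comp
        ((schwartz_contDiffOn f).continuousOn.continuousAt ((isOpen_orthant d).mem_nhds hx))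
    exact ContinuousAt.comp (f := (WithLp.ofLp : EuclideanSpace ℝ (Fin d) → Fin d → ℝ)) h1
      (PiLp.continuous_ofLp 2 _).continuousAt
  have hinv := hHint.fourierInv_fourier_eq (by rw [hF]; exact integrable_zero _ _ _) hc
  have h0 : H (WithLp.toLp 2 x) = 0 := by
    rw [← hinv, hF, Real.fourierInv_eq']
    simp
  have h1 : φ (f x) * ∏ i, Complex.exp (-(x i : ℂ) / 2) = 0 := h0
  exact (mul_eq_zero.1 h1).resolve_right
    (Finset.prod_ne_zero_iff.2 fun i _ => Complex.exp_ne_zero _)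

/-- A function in `𝒮(ℝ^d_+)` is determined by its Laguerre coefficients. -/
theorem eq_zero_of_coeff_eq_zero {f : SchwartzOrthant 𝕜 d} (hf : ∀ n, coeff f n = 0) : f = 0 := by
  refine schwartz_ext fun x hx => ?_
  have h1 := apply_eq_zero_of_coeff_eq_zero hf (Complex.ofRealCLM.comp RCLike.reCLM) hx
  have h2 := apply_eq_zero_of_coeff_eq_zero hf (Complex.ofRealCLM.comp RCLike.imCLM) hx
  change f x = 0
  refine RCLike.ext ?_ ?_
  · simpa using h1
  · simpa using h2

end Uniqueness

/-! ### Laguerre series and the topological isomorphism. -/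

section Isomorphism

variable {𝕜 : Type*} [RCLike 𝕜] {d : ℕ}

/-- Comparison with a product of one-dimensional series: each `n_i + 1` is at most `1 + |n|`. -/
theorem summable_inv_indexWeight_pow (d : ℕ) :
    Summable fun n : Fin d → ℕ => (indexWeight n ^ (2 * d))⁻¹ := by
  have h1 : Summable fun m : ℕ => ‖(((m : ℝ) + 1) ^ 2)⁻¹‖ := by
    have := (summable_nat_add_iff 1).2 (Real.summable_nat_pow_inv.2 (one_lt_two))
    simpa using this
  have h2 := (hasSum_pi_prod (d := d) (f := fun _ (m : ℕ) => (((m : ℝ) + 1) ^ 2)⁻¹)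
    (fun _ => h1) fun _ => h1.of_norm.hasSum).2.summable
  refine Summable.of_nonneg_of_le (fun n => inv_nonneg.2 (pow_nonneg (indexWeight_pos n).le _))
    (fun n => ?_) h2
  rw [Finset.prod_inv_distrib]
  have h3 : ∏ i, ((n i : ℝ) + 1) ^ 2 ≤ indexWeight n ^ (2 * d) := by
    calc _ ≤ ∏ _i : Fin d, indexWeight n ^ 2 := by
          refine Finset.prod_le_prod (fun _ _ => by positivity) fun i _ => ?_
          gcongr
          exact coord_add_one_le_indexWeight n i
      _ = _ := by simp [pow_mul]
  exact inv_anti₀ (Finset.prod_pos fun _ _ => by positivity) h3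

/-- A rapidly decreasing sequence is bounded by its seminorms. -/
theorem norm_mul_weight_le_rapidSeminorm (k : ℕ) (a : RapidSeq 𝕜 d) (n : Fin d → ℕ) :
    ‖a n‖ * indexWeight n ^ k ≤ rapidSeminorm 𝕜 d k a := by
  refine Real.le_sqrt_of_sq_le ?_
  have h1 := (a.2 k).le_tsum n fun m _ => rapidTerm_nonneg k a.1 m
  refine le_of_eq_of_le ?_ h1
  rw [rapidTerm, mul_pow, ← pow_mul, mul_comm k 2]
  rfl

/-- Seminorm bounds for the terms of Laguerre series with rapidly decreasing coefficients. -/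
theorem exists_term_bound {q : Seminorm 𝕜 (SchwartzOrthant 𝕜 d)} (hq : Continuous q) :
    ∃ (C : ℝ) (k : ℕ), 0 ≤ C ∧ ∀ (a : (Fin d → ℕ) → 𝕜) (B : ℝ),
      (∀ n, ‖a n‖ * indexWeight n ^ k ≤ B) → ∀ n,
        q (a n • laguerre 𝕜 n) ≤ B * (C * (indexWeight n ^ (2 * d))⁻¹) := by
  obtain ⟨C, M, hC, hb⟩ := polyGrowth_of_continuous hq
  -- The exponent `M` offsets the growth of `q` along the Laguerre functions, and `2 * d` leaves a
  -- summable weight.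
  refine ⟨C, M + 2 * d, hC, fun a B hB n => ?_⟩
  have hw : 0 < indexWeight n ^ (2 * d) := pow_pos (indexWeight_pos n) _
  rw [map_smul_eq_mul, ← mul_assoc, ← div_eq_mul_inv, le_div_iff₀ hw]
  calc ‖a n‖ * q (laguerre 𝕜 n) * indexWeight n ^ (2 * d)
      ≤ ‖a n‖ * (C * indexWeight n ^ M) * indexWeight n ^ (2 * d) := by
        gcongr
        exact hb n
    _ = (‖a n‖ * indexWeight n ^ (M + 2 * d)) * C := by rw [pow_add]; ring
    _ ≤ B * C := by gcongr; exact hB n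

theorem summable_seminorm_of_bounds {a : (Fin d → ℕ) → 𝕜}
    (ha : ∀ k : ℕ, ∃ B, ∀ n, ‖a n‖ * indexWeight n ^ k ≤ B)
    {q : Seminorm 𝕜 (SchwartzOrthant 𝕜 d)} (hq : Continuous q) :
    Summable fun n => q (a n • laguerre 𝕜 n) := by
  obtain ⟨C, k, -, h⟩ := exists_term_bound hq
  obtain ⟨B, hB⟩ := ha k
  exact Summable.of_nonneg_of_le (fun _ => apply_nonneg _ _) (h a B hB)
    (((summable_inv_indexWeight_pow d).mul_left C).mul_left B)

theorem exists_hasSum_laguerre {a : (Fin d → ℕ) → 𝕜}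
    (ha : ∀ k : ℕ, ∃ B, ∀ n, ‖a n‖ * indexWeight n ^ k ≤ B) :
    ∃ f : SchwartzOrthant 𝕜 d, HasSum (fun n => a n • laguerre 𝕜 n) f :=
  exists_hasSum_of_summable_seminorms fun k p =>
    summable_seminorm_of_bounds ha (continuous_schwartzSeminorm k p)

/-- The coefficient functional `f ↦ a_n(f)`. -/
def coeffCLM (n : Fin d → ℕ) : SchwartzOrthant 𝕜 d →L[𝕜] 𝕜 where
  toLinearMap := pairing (laguerre 𝕜 n)
  cont := by
    obtain ⟨q, hq, hb⟩ := exists_coeff_bound 𝕜 d 0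
    refine WithSeminorms.continuous_of_continuous_comp (norm_withSeminorms 𝕜 𝕜) _ fun _ => ?_
    refine Seminorm.continuous_of_le hq fun f => ?_
    have := hb f n
    rwa [pow_zero, mul_one] at this

theorem coeffCLM_apply (n : Fin d → ℕ) (f : SchwartzOrthant 𝕜 d) : coeffCLM n f = coeff f n := rfl

/-- A continuous coefficient functional passes through the sum, and orthonormality leaves one term.
-/
theorem coeff_of_hasSum {a : (Fin d → ℕ) → 𝕜} {f : SchwartzOrthant 𝕜 d}
    (h : HasSum (fun n => a n • laguerre 𝕜 n) f) (m : Fin d → ℕ) : coeff f m = a m := by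
  have h1 := h.mapL (coeffCLM m)
  refine h1.unique ?_
  have h2 : ∀ n, coeffCLM m (a n • laguerre 𝕜 n) = if n = m then a m else 0 := by
    intro n
    rw [map_smul, coeffCLM_apply, coeff_laguerre]
    split_ifs with hn
    · simp [hn]
    · simp
  simp only [h2]
  exact hasSum_ite_eq m (a m)

theorem eq_of_coeff_eq {f g : SchwartzOrthant 𝕜 d} (h : ∀ n, coeff f n = coeff g n) : f = g := by
  refine sub_eq_zero.1 (eq_zero_of_coeff_eq_zero fun n => ?_)
  rw [← coeffCLM_apply, map_sub, coeffCLM_apply, coeffCLM_apply, h n, sub_self]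

theorem coeff_bounds (f : SchwartzOrthant 𝕜 d) (k : ℕ) :
    ∃ B, ∀ n, ‖coeff f n‖ * indexWeight n ^ k ≤ B := by
  obtain ⟨q, -, hb⟩ := exists_coeff_bound 𝕜 d k
  exact ⟨q f, hb f⟩

/-- The Laguerre expansion converges in `𝒮(ℝ^d_+)` to the function. -/
theorem hasSum_laguerre_expansion (f : SchwartzOrthant 𝕜 d) :
    HasSum (fun n => coeff f n • laguerre 𝕜 n) f := by
  obtain ⟨g, hg⟩ := exists_hasSum_laguerre (coeff_bounds f)
  -- The sum of the series has the same coefficients as `f`, hence equals `f`.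
  obtain rfl : g = f := eq_of_coeff_eq fun n => coeff_of_hasSum hg n
  exact hg

/-- A sup bound with `d` further powers of the weight implies an `ℓ²` bound. -/
theorem rapidTerm_le {k : ℕ} {a : (Fin d → ℕ) → 𝕜} {B : ℝ} {n : Fin d → ℕ}
    (h : ‖a n‖ * indexWeight n ^ (k + d) ≤ B) :
    rapidTerm k a n ≤ B ^ 2 * (indexWeight n ^ (2 * d))⁻¹ := by
  have hw : 0 < indexWeight n ^ (2 * d) := pow_pos (indexWeight_pos n) _
  rw [← div_eq_mul_inv, le_div_iff₀ hw]
  have h0 : 0 ≤ ‖a n‖ * indexWeight n ^ (k + d) :=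
    mul_nonneg (norm_nonneg _) (pow_nonneg (indexWeight_pos n).le _)
  refine le_of_eq_of_le ?_ (pow_le_pow_left₀ h0 h 2)
  rw [mul_pow, ← pow_mul, add_mul, pow_add, mul_comm k 2, mul_comm d 2, ← mul_assoc]
  rfl

variable (𝕜 d) in
/-- The coefficient map `ι : 𝒮(ℝ^d_+) → s`. -/
def coeffMap : SchwartzOrthant 𝕜 d →ₗ[𝕜] RapidSeq 𝕜 d where
  toFun f := ⟨coeff f, fun k => by
    obtain ⟨B, hB⟩ := coeff_bounds f (k + d)
    exact Summable.of_nonneg_of_le (rapidTerm_nonneg k _) (fun n => rapidTerm_le (hB n))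
      ((summable_inv_indexWeight_pow d).mul_left _)⟩
  map_add' f g := Subtype.ext (funext fun n => map_add (coeffCLM n) f g)
  map_smul' c f := Subtype.ext (funext fun n => map_smul (coeffCLM n) c f)

theorem coeffMap_apply (f : SchwartzOrthant 𝕜 d) (n : Fin d → ℕ) : coeffMap 𝕜 d f n = coeff f n :=
  rfl

theorem continuous_coeffMap : Continuous (coeffMap 𝕜 d) := by
  refine WithSeminorms.continuous_of_continuous_comp (rapid_withSeminorms 𝕜 d) _ fun k => ?_
  obtain ⟨q, hq, hb⟩ := exists_coeff_bound 𝕜 d (k + d)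
  set A := ∑' n : Fin d → ℕ, (indexWeight n ^ (2 * d))⁻¹
  let c : NNReal := ⟨√A, Real.sqrt_nonneg _⟩
  refine Seminorm.continuous_of_le (q := c • q) (hq.const_smul _) fun f => ?_
  have h1 : ∑' n, rapidTerm k (coeff f) n ≤ q f ^ 2 * A := by
    rw [← tsum_mul_left]
    exact ((coeffMap 𝕜 d f).2 k).tsum_le_tsum (fun n => rapidTerm_le (hb f n))
      ((summable_inv_indexWeight_pow d).mul_left _)
  change √(∑' n, rapidTerm k (coeff f) n) ≤ √A * q f
  refine (Real.sqrt_le_sqrt h1).trans_eq ?_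
  rw [Real.sqrt_mul (by positivity), Real.sqrt_sq (apply_nonneg _ _), mul_comm]

theorem rapid_bounds (a : RapidSeq 𝕜 d) (k : ℕ) :
    ∃ B, ∀ n, ‖a n‖ * indexWeight n ^ k ≤ B :=
  ⟨_, norm_mul_weight_le_rapidSeminorm k a⟩

/-- Injectivity is uniqueness of the coefficients. A preimage of `a` is the sum of its Laguerre
series. -/
theorem coeffMap_bijective : Function.Bijective (coeffMap 𝕜 d) := by
  refine ⟨fun f g h => eq_of_coeff_eq fun n => ?_, fun a => ?_⟩
  · rw [← coeffMap_apply, h, coeffMap_apply]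
  · obtain ⟨f, hf⟩ := exists_hasSum_laguerre (rapid_bounds a)
    exact ⟨f, Subtype.ext (funext fun n => coeff_of_hasSum hf n)⟩

variable (𝕜 d) in
/-- The coefficient map as a linear bijection. -/
def coeffEquiv : SchwartzOrthant 𝕜 d ≃ₗ[𝕜] RapidSeq 𝕜 d :=
  LinearEquiv.ofBijective (coeffMap 𝕜 d) coeffMap_bijective

/-- The inverse is summation of the Laguerre series, so termwise bounds linear in one seminorm of
`a` give continuity without an open mapping theorem. -/
theorem continuous_coeffEquiv_symm : Continuous (coeffEquiv 𝕜 d).symm := by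
  refine continuous_of_seminorm_bounds (coeffEquiv 𝕜 d).symm.toLinearMap fun k p => ?_
  have hq := continuous_schwartzSeminorm (𝕜 := 𝕜) k p
  obtain ⟨C, M, hC, h⟩ := exists_term_bound hq
  set A := ∑' n : Fin d → ℕ, (indexWeight n ^ (2 * d))⁻¹
  have hA : 0 ≤ A := tsum_nonneg fun n => inv_nonneg.2 (pow_nonneg (indexWeight_pos n).le _)
  let c : NNReal := ⟨C * A, by positivity⟩
  refine ⟨c • rapidSeminorm 𝕜 d M,
    ((rapid_withSeminorms 𝕜 d).continuous_seminorm M).const_smul _, fun a => ?_⟩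
  change schwartzSeminorm 𝕜 d k p ((coeffEquiv 𝕜 d).symm a) ≤ C * A * rapidSeminorm 𝕜 d M a
  set f := (coeffEquiv 𝕜 d).symm a with hf
  have hcoef : ∀ n, coeff f n = a n := fun n => by
    have : coeffMap 𝕜 d f = a := (coeffEquiv 𝕜 d).apply_symm_apply a
    rw [← coeffMap_apply, this]
  have hterm := h (coeff f) (rapidSeminorm 𝕜 d M a) fun n => by
    rw [hcoef]; exact norm_mul_weight_le_rapidSeminorm M a n
  have hsum := hasSum_laguerre_expansion f
  have hlim := (hq.tendsto f).comp hsum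
  -- It suffices to bound the finite partial sums uniformly, since the seminorm is continuous.
  refine le_of_tendsto hlim (Filter.Eventually.of_forall fun s => ?_)
  have hS := ((summable_inv_indexWeight_pow d).mul_left C).mul_left (rapidSeminorm 𝕜 d M a)
  calc schwartzSeminorm 𝕜 d k p (∑ n ∈ s, coeff f n • laguerre 𝕜 n)
      ≤ ∑ n ∈ s, schwartzSeminorm 𝕜 d k p (coeff f n • laguerre 𝕜 n) :=
        Finset.le_sum_of_subadditive _ (map_zero _).le (map_add_le_add _) _ _
    _ ≤ ∑ n ∈ s, rapidSeminorm 𝕜 d M a * (C * (indexWeight n ^ (2 * d))⁻¹) :=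
        Finset.sum_le_sum fun n _ => hterm n
    _ ≤ ∑' n, rapidSeminorm 𝕜 d M a * (C * (indexWeight n ^ (2 * d))⁻¹) :=
        hS.sum_le_tsum s fun n _ => mul_nonneg (apply_nonneg _ _)
          (mul_nonneg hC (inv_nonneg.2 (pow_nonneg (indexWeight_pos n).le _)))
    _ = C * A * rapidSeminorm 𝕜 d M a := by
        rw [tsum_mul_left, tsum_mul_left]; ring

variable (𝕜 d) in
/-- The coefficient map as a topological isomorphism `𝒮(ℝ^d_+) ≃ s`. -/
def coeffCLE : SchwartzOrthant 𝕜 d ≃L[𝕜] RapidSeq 𝕜 d where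
  toLinearEquiv := coeffEquiv 𝕜 d
  continuous_toFun := continuous_coeffMap
  continuous_invFun := continuous_coeffEquiv_symm

end Isomorphism

end LaguerreOrthant
end

theorem mainTheorem3 (𝕜 : Type*) [RCLike 𝕜] (d : ℕ) :
    (∀ (f : LaguerreOrthant.SchwartzOrthant 𝕜 d) (n : Fin d → ℕ),
      MeasureTheory.IntegrableOn (fun x => f x * LaguerreOrthant.laguerre 𝕜 n x)
        (LaguerreOrthant.orthant d)) ∧
    (∀ f : LaguerreOrthant.SchwartzOrthant 𝕜 d,
      (∀ q : Seminorm 𝕜 (LaguerreOrthant.SchwartzOrthant 𝕜 d), Continuous q →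
        Summable fun n : Fin d → ℕ =>
          q (LaguerreOrthant.coeff f n • LaguerreOrthant.laguerre 𝕜 n)) ∧
      HasSum (fun n : Fin d → ℕ =>
        LaguerreOrthant.coeff f n • LaguerreOrthant.laguerre 𝕜 n) f) ∧
    ∃ ι : LaguerreOrthant.SchwartzOrthant 𝕜 d ≃L[𝕜] LaguerreOrthant.RapidSeq 𝕜 d,
      ∀ (f : LaguerreOrthant.SchwartzOrthant 𝕜 d) (n : Fin d → ℕ),
        ι f n = LaguerreOrthant.coeff f n :=
  ⟨fun f n => LaguerreOrthant.integrableOn_schwartz_mul f (LaguerreOrthant.laguerre 𝕜 n),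
    fun f => ⟨fun _ hq =>
      LaguerreOrthant.summable_seminorm_of_bounds (LaguerreOrthant.coeff_bounds f) hq,
      LaguerreOrthant.hasSum_laguerre_expansion f⟩,
    LaguerreOrthant.coeffCLE 𝕜 d, fun _ _ => rfl⟩
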